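/- **Setting.** Let $m\in\mathbb N$, $[m]=\{1,\dots,m\}$ (the colours), let $\chi_1,\dots,\chi_m$ be probability distributions on $\mathbb N_0^m$, and for each $j\in[m]$ let $S_j$ be a non-empty proper subset of $[m]$; write $S_j^c=[m]\setminus S_j$. In the rooted multi-type Galton–Watson tree every vertex $v$ has a colour $\sigma(v)\in[m]$, and a vertex $v$ of colour $i$ has, independently of all else, $X_{v,k}$ children of colour $k$ for $k\in[m]$, where $(X_{v,1},\dots,X_{v,m})\sim\chi_i$. Edges are directed from parent to child. A token starts at the root, and two players alternately move it along edges: from a vertex $u$, P1 (called Stopper in the escape game) may move it only to a child with colour in $S_{\sigma(u)}$, and P2 (Escaper) only to a child with colour in $S_{\sigma(u)}^c$. In the *normal* game, the first player unable to move loses; in the *misère* game, the first player unable to move wins; in both, an infinite play is a draw. In the *escape* game Stopper wins if either player is ever unable to move, and Escaper wins otherwise. A player *wins* (*loses*) the game if that player (the opponent) has a winning strategy. For $i\in\{1,2\}$ and $j\in[m]$, given that the root has colour $j$, let $nw_{i,j}$ and $nl_{i,j}$ (respectively $mw_{i,j}$ and $ml_{i,j}$) be the probabilities that P$i$ wins and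 that P$i$ loses the normal (respectively misère) game when P$i$ plays the first round; let $esw_j$ be the probability that Stopper wins the escape game when Stopper plays the first round, and $eel_j$ the probability that Escaper loses it when Escaper plays the first round. Given that a vertex $v$ has colour $j$, let $\alpha_j$ (respectively $\beta_j$) be the probability that it has no child with colour in $S_j$ (respectively $S_j^c$). For $A\subseteq[m]$ let $G_{j,A}:[0,1]^A\to[0,1]$ be the probability generating function of $(X_{v,k})_{k\in A}$ given $\sigma(v)=j$; differentiability and partial derivatives $\partial_k$ are taken on the cube $[0,1]^A$ (one-sided on its boundary). **Theorem.** (i) For each $j\in[m]$: $nw_{1,j}\le esw_j$, $nl_{2,j}\le eel_j$, $mw_{1,j}\le esw_j$ and $ml_{2,j}\le eel_j$. (ii) For each $j\in[m]$ such that $G_{j,S_j}$ and $G_{j,S_j^c}$ are differentiable, $$esw_j\ \ge\ \alpha_j+e\,(1-\alpha_j)+\sum_{k\in S_j}(eel_k-e)\,\partial_kG_{j,S_j}\big((1-eel_t)_{t\in S_j}\big)\ \ge\ e,\qquad e=\min_{t\in S_j}eel_t;$$ $$mw_{1,j}\ \ge\ \alpha_j+l\,(1-\alpha_j)+\sum_{k\in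 S_j}(ml_{2,k}-l)\,\partial_kG_{j,S_j}\big((1-ml_{2,t})_{t\in S_j}\big)\ \ge\ l,\qquad l=\min_{t\in S_j}ml_{2,t};$$ $$mw_{2,j}\ \ge\ \beta_j+l'\,(1-\beta_j)+\sum_{k\in S_j^c}(ml_{1,k}-l')\,\partial_kG_{j,S_j^c}\big((1-ml_{1,t})_{t\in S_j^c}\big)\ \ge\ l',\qquad l'=\min_{t\in S_j^c}ml_{1,t}.$$ (iii) Suppose that for each $j\in[m]$ the function $G_{j,S_j}$ is convex and continuously differentiable and $G_{j,S_j^c}$ is continuous. If $$\alpha_j\le\sum_{i\in S_j}\beta_i\,\mathbb P\big[X_{v,i}=1,\ X_{v,k}=0\ \text{for all}\ k\in S_j\setminus\{i\}\,\big|\,\sigma(v)=j\big]\quad\text{for each }j\in[m],$$ then $nl_{1,j}\le ml_{1,j}$ for all $j\in[m]$. If $$\alpha_j\ge\sum_{i\in S_j}\beta_i\,\mathbb E\big[X_{v,i}\,\big|\,\sigma(v)=j\big]\quad\text{for each }j\in[m],$$ then $nw_{1,j}\le mw_{1,j}$ for all $j\in[m]$. Symmetrically, suppose that for each $j\in[m]$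 the function $G_{j,S_j^c}$ is convex and continuously differentiable and $G_{j,S_j}$ is continuous. If $\beta_j\le\sum_{i\in S_j^c}\alpha_i\,\mathbb P[X_{v,i}=1,\ X_{v,k}=0\ \text{for all}\ k\in S_j^c\setminus\{i\}\mid\sigma(v)=j]$ for each $j\in[m]$, then $nl_{2,j}\le ml_{2,j}$ for all $j\in[m]$. If $\beta_j\ge\sum_{i\in S_j^c}\alpha_i\,\mathbb E[X_{v,i}\mid\sigma(v)=j]$ for each $j\in[m]$, then $nw_{2,j}\le mw_{2,j}$ for all $j\in[m]$. -/

import Mathlib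

open MeasureTheory ProbabilityTheory
open scoped ENNReal

namespace MultiTypeGW

noncomputable section

/-! ### The games on a directed graph with coloured vertices -/

/-- The two players. In the escape game Stopper is `P1` and Escaper is `P2`. -/
inductive Player
  | P1
  | P2

/-- The opponent of a player. -/
def Player.other : Player → Player
  | .P1 => .P2
  | .P2 => .P1

/-- The three games. -/
inductive Game
  | normal
  | misere
  | escape

/-- A directed graph on `V` whose vertices are coloured with the colours `Fin m`. -/
structure ColouredDigraph (m : ℕ) (V : Type*) where
  /-- the colour of a vertex -/
  colour : V → Fin m
  /-- `edge u v`: there is an edge directed from `u` to `v` -/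
  edge : V → V → Prop

/-- The set of colours to which player `i` may move from a vertex of colour `j`:
`S j` for `P1` / Stopper, and its complement for `P2` / Escaper. -/
def moveSet {m : ℕ} (S : Fin m → Finset (Fin m)) : Player → Fin m → Finset (Fin m)
  | .P1, j => S j
  | .P2, j => (S j)ᶜ

/-- The edge from `u` to `v` is permissible for player `i`. -/
def Permissible {m : ℕ} {V : Type*} (D : ColouredDigraph m V) (S : Fin m → Finset (Fin m))
    (i : Player) (u v : V) : Prop :=
  D.edge u v ∧ D.colour v ∈ moveSet S i (D.colour u)

/-- The player whose turn it is after `k` moves have been made, if `first` plays the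
first round. -/
def mover (first : Player) (k : ℕ) : Player := if Even k then first else first.other

/-- A complete play starting at `v₀` with `first` playing the first round:
`len` is the total number of moves made (possibly infinite), `pos k` is the position of the
token after `k` moves (irrelevant for `k > len`), every move is along an edge permissible for
the player who makes it, and if `len` is finite then the player to move next is unable to. -/
structure IsPlay {m : ℕ} {V : Type*} (D : ColouredDigraph m V) (S : Fin m → Finset (Fin m))
    (first : Player) (v₀ : V) (len : ℕ∞) (pos : ℕ → V) : Prop where
  start : pos 0 = v₀
  step : ∀ k : ℕ, (k : ℕ∞) < len → Permissible D S (mover first k) (pos k) (pos (k + 1))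
  stuck : ∀ n : ℕ, len = n → ∀ w, ¬ Permissible D S (mover first n) (pos n) w

/-- The player `q` wins a play with `len` moves in which `first` played the first round. -/
def WinsPlay : Game → (first q : Player) → (len : ℕ∞) → Prop
  | .normal, first, q, len => ∃ n : ℕ, len = n ∧ mover first n = q.other
  | .misere, first, q, len => ∃ n : ℕ, len = n ∧ mover first n = q
  | .escape, _, .P1, len => len ≠ ⊤
  | .escape, _, .P2, len => len = ⊤

/-- `s` is a strategy for player `q`: it prescribes a permissible move wherever there is one.
(In a tree, with given initial vertex and first player, the position of the token determines the
whole history of the game, so a strategy is a function of the position.) -/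
def IsStrategy {m : ℕ} {V : Type*} (D : ColouredDigraph m V) (S : Fin m → Finset (Fin m))
    (q : Player) (s : V → V) : Prop :=
  ∀ u, (∃ w, Permissible D S q u w) → Permissible D S q u (s u)

/-- In the game `g` with initial vertex `v₀` and first round played by `first`, player `q` has a
strategy that wins against every way of playing of the opponent. -/
def HasWinningStrategy {m : ℕ} {V : Type*} (D : ColouredDigraph m V)
    (S : Fin m → Finset (Fin m)) (g : Game) (first q : Player) (v₀ : V) : Prop :=
  ∃ s : V → V, IsStrategy D S q s ∧
    ∀ (len : ℕ∞) (pos : ℕ → V), IsPlay D S first v₀ len pos →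
      (∀ k : ℕ, (k : ℕ∞) < len → mover first k = q → pos (k + 1) = s (pos k)) →
      WinsPlay g first q len

/-- Player `i` wins the game `g` with initial vertex `v₀` when `i` plays the first round. -/
def FirstWins {m : ℕ} {V : Type*} (D : ColouredDigraph m V) (S : Fin m → Finset (Fin m))
    (g : Game) (i : Player) (v₀ : V) : Prop :=
  HasWinningStrategy D S g i i v₀

/-- Player `i` loses the game `g` with initial vertex `v₀` when `i` plays the first round. -/
def FirstLoses {m : ℕ} {V : Type*} (D : ColouredDigraph m V) (S : Fin m → Finset (Fin m))
    (g : Game) (i : Player) (v₀ : V) : Prop :=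
  HasWinningStrategy D S g i i.other v₀

/-! ### The rooted multi-type Galton-Watson tree -/

/-- Ulam-Harris names of potential vertices. The root is `[]`, and `(c, a) :: u` is the
`a`-th child (counting from `0`) of colour `c` of `u`. -/
abbrev Node (m : ℕ) : Type := List (Fin m × ℕ)

/-- The colour of a node, if the root has colour `j`. -/
def nodeColour {m : ℕ} (j : Fin m) : Node m → Fin m
  | [] => j
  | (c, _) :: _ => c

/-- A realization: the colour of the root, and for each potential vertex `u` the numbers
`X u c` of its children of colour `c`. -/
abbrev Realization (m : ℕ) : Type := Fin m × (Node m → Fin m → ℕ)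

/-- The rooted coloured tree given by a realization, with edges directed from parent to child.
The vertices of the tree are the nodes that can be reached from the root `[]` along edges;
no other node is ever visited by a game that starts at the root. -/
def Realization.tree {m : ℕ} (T : Realization m) : ColouredDigraph m (Node m) where
  colour := nodeColour T.1
  edge u v := ∃ (c : Fin m) (a : ℕ), a < T.2 u c ∧ v = (c, a) :: u

/-- The law of the multi-type Galton-Watson tree with offspring distributions `χ` whose root has
colour `j`: the offspring vectors of the nodes are independent, and the one of a node of colour
`c` has distribution `χ c`. -/
def gwLawFrom {m : ℕ} (χ : Fin m → PMF (Fin m → ℕ)) (j : Fin m) : Measure (Realization m) :=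
  (Measure.infinitePi fun v : Node m => (χ (nodeColour j v)).toMeasure).map (Prod.mk j)

/-- The law of the multi-type Galton-Watson tree whose root colour is chosen according to `p`. -/
def gwLaw {m : ℕ} (p : PMF (Fin m)) (χ : Fin m → PMF (Fin m → ℕ)) : Measure (Realization m) :=
  ∑ j, p j • gwLawFrom χ j

instance {m : ℕ} (χ : Fin m → PMF (Fin m → ℕ)) (j : Fin m) :
    IsProbabilityMeasure (gwLawFrom χ j) :=
  Measure.isProbabilityMeasure_map (by fun_prop)

/-- `gwLawFrom χ j` is the conditional law of the tree given that the root has colour `j`. -/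
theorem cond_gwLaw {m : ℕ} (p : PMF (Fin m)) (χ : Fin m → PMF (Fin m → ℕ)) (j : Fin m)
    (hj : p j ≠ 0) : (gwLaw p χ)[|{T | T.1 = j}] = gwLawFrom χ j := by
  have hmeas : MeasurableSet {T : Realization m | T.1 = j} :=
    measurable_fst (measurableSet_singleton j)
  have key : ∀ (i : Fin m) (t : Set (Realization m)), MeasurableSet t →
      gwLawFrom χ i ({T | T.1 = j} ∩ t) = if i = j then gwLawFrom χ i t else 0 := by
    intro i t ht
    unfold gwLawFrom
    rw [Measure.map_apply (by fun_prop) (hmeas.inter ht), Measure.map_apply (by fun_prop) ht]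
    split_ifs with h
    · congr 1
      ext x
      simp [h]
    · convert measure_empty (μ := Measure.infinitePi fun v : Node m =>
        (χ (nodeColour i v)).toMeasure)
      ext x
      simp [h]
  have hall : ∀ t : Set (Realization m), MeasurableSet t →
      gwLaw p χ ({T | T.1 = j} ∩ t) = p j * gwLawFrom χ j t := by
    intro t ht
    simp [gwLaw, Measure.finsetSum_apply, key _ t ht]
  ext t ht
  have h1 : gwLaw p χ {T | T.1 = j} = p j := by
    simpa using hall Set.univ MeasurableSet.univ
  rw [cond_apply hmeas, hall t ht, h1, ← mul_assoc,
    ENNReal.inv_mul_cancel hj (PMF.apply_ne_top p j), one_mul]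

/-- The probability that player `i` wins the game `g` that starts at the root with `i` playing the
first round, given that the root has colour `j`. -/
def winProb {m : ℕ} (χ : Fin m → PMF (Fin m → ℕ)) (S : Fin m → Finset (Fin m))
    (g : Game) (i : Player) (j : Fin m) : ℝ :=
  (gwLawFrom χ j).real {T | FirstWins T.tree S g i []}

/-- The probability that player `i` loses the game `g` that starts at the root with `i` playing the
first round, given that the root has colour `j`. -/
def lossProb {m : ℕ} (χ : Fin m → PMF (Fin m → ℕ)) (S : Fin m → Finset (Fin m))
    (g : Game) (i : Player) (j : Fin m) : ℝ :=
  (gwLawFrom χ j).real {T | FirstLoses T.tree S g i []}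

section Names

variable {m : ℕ} (χ : Fin m → PMF (Fin m → ℕ)) (S : Fin m → Finset (Fin m))

/-- Win probability of player `i` in the normal game. -/
abbrev nw (i : Player) (j : Fin m) : ℝ := winProb χ S .normal i j
/-- Loss probability of player `i` in the normal game. -/
abbrev nl (i : Player) (j : Fin m) : ℝ := lossProb χ S .normal i j
/-- Win probability of player `i` in the misère game. -/
abbrev mw (i : Player) (j : Fin m) : ℝ := winProb χ S .misere i j
/-- Loss probability of player `i` in the misère game. -/
abbrev ml (i : Player) (j : Fin m) : ℝ := lossProb χ S .misere i j
/-- Probability that Stopper, playing the first round, wins the escape game. -/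
abbrev esw (j : Fin m) : ℝ := winProb χ S .escape .P1 j
/-- Probability that Escaper, playing the first round, loses the escape game. -/
abbrev eel (j : Fin m) : ℝ := lossProb χ S .escape .P2 j

/-! ### Quantities attached to the offspring distributions -/

/-- The probability that a vertex of colour `j` has no child with a colour in `A`. -/
def noChildProb (j : Fin m) (A : Finset (Fin m)) : ℝ :=
  (χ j).toMeasure.real {n | ∀ k ∈ A, n k = 0}

/-- The probability that a vertex of colour `j` has no child with a colour in `S j`. -/
def alphaS (j : Fin m) : ℝ := noChildProb χ j (S j)

/-- The probability that a vertex of colour `j` has no child with a colour outside `S j`. -/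
def betaS (j : Fin m) : ℝ := noChildProb χ j (S j)ᶜ

/-- The probability that a vertex of colour `j` has exactly one child with a colour in `A`, and
that this child has colour `i` (for `i ∈ A`). -/
def onlyChildProb (j : Fin m) (A : Finset (Fin m)) (i : Fin m) : ℝ :=
  (χ j).toMeasure.real {n | n i = 1 ∧ ∀ k ∈ A \ {i}, n k = 0}

/-- The expected number (possibly infinite) of children of colour `i` of a vertex of colour `j`. -/
def meanChildren (j i : Fin m) : ℝ≥0∞ :=
  ∫⁻ n, (n i : ℝ≥0∞) ∂(χ j).toMeasure

/-- The joint distribution of the numbers of children with colours in `A` of a vertex of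
colour `j`. -/
def marginal (j : Fin m) (A : Finset (Fin m)) : PMF (A → ℕ) :=
  (χ j).map fun n k => n k

/-- The probability generating function of `marginal χ j A`; it is meaningful on the cube
`Set.Icc 0 1`, that is `[0,1]^A`. -/
def pgf (j : Fin m) (A : Finset (Fin m)) (x : A → ℝ) : ℝ :=
  ∑' n : A → ℕ, (∏ k, x k ^ n k) * (marginal χ j A n).toReal

end Names

/-- The partial derivative at `x ∈ [0,1]^A` in direction `k` of a function on the cube `[0,1]^A`
(one-sided if `x k` is `0` or `1`). -/
def partialDeriv {m : ℕ} {A : Finset (Fin m)} (G : (A → ℝ) → ℝ) (k : A) (x : A → ℝ) : ℝ :=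
  derivWithin (fun y : ℝ => G (Function.update x k y)) (Set.Icc 0 1) (x k)

end

end MultiTypeGW

open MultiTypeGW

open Filter Topology

namespace MultiTypeGW

/-! ### Winning within a bounded number of moves -/

/-! All three games have one form: a player `q` tries to force a finite play whose stuck player
satisfies a condition `t`. The condition is `(· ≠ q)` in the normal game, `(· = q)` in the misère
game, and always true with `q = .P1` in the escape game. By a König argument, in a locally finite
graph a winning strategy exists iff `q` can win within some bounded number of moves
(`hasWinningStrategy_iff`). In the tree, these bounded events are expressed through the independent
subtrees of the root's children, so `real_childrenIn` yields recursions in the generating functions.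
Letting the bound tend to infinity gives `eventualWinProb_self` and `eventualWinProb_other`.

Part (i) is transfer of strategies: winning the normal or misère game forces a finite play.

Part (ii) rests on the equation `w = 1 - G (1 - l) + α`, valid when `q` moves first and wins by
being stuck. A generating function need not be convex on the cube, but it is convex along segments
with nonnegative direction. The tangent at `1 - l` towards the larger constant vector `1 - e`,
together with `G (r, …, r) ≤ r + (1 - r) α`, gives the bound (`one_sub_pgf_bounds`).

Part (iii) compares the bounded normal values with the eventual misère values by induction on the
bound. At one of the two players' turns the induction carries a gap equal to the probability of
being stuck. The hypotheses say exactly that this gap compensates the stuck probability at the other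
player's turn. -/

theorem Player.other_ne (p : Player) : p.other ≠ p := by cases p <;> simp [Player.other]

theorem Player.other_other (p : Player) : p.other.other = p := by cases p <;> rfl

theorem Player.eq_other_of_ne {p q : Player} (h : p ≠ q) : p = q.other := by
  cases p <;> cases q <;> simp_all [Player.other]

theorem mover_zero (p : Player) : mover p 0 = p := by simp [mover]

theorem mover_succ (p : Player) (k : ℕ) : mover p (k + 1) = (mover p k).other := by
  unfold mover
  by_cases h : Even k <;> simp [h, Nat.even_add_one, Player.other_other]

open Classical in
/-- Player `q` can force the game to end in at most `n - 1` further moves with a player `p` such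
that `t p` being unable to move, if player `p` is to move at `u`. -/
def WinsWithin {m : ℕ} {V : Type*} (D : ColouredDigraph m V) (S : Fin m → Finset (Fin m))
    (q : Player) (t : Player → Prop) : ℕ → Player → V → Prop
  | 0, _, _ => False
  | n + 1, p, u =>
    if p = q then
      ((∀ w, ¬ Permissible D S p u w) ∧ t p) ∨
        ∃ w, Permissible D S p u w ∧ WinsWithin D S q t n p.other w
    else
      ((∀ w, ¬ Permissible D S p u w) → t p) ∧
        ∀ w, Permissible D S p u w → WinsWithin D S q t n p.other w

section Graph

variable {m : ℕ} {V : Type*} {D : ColouredDigraph m V} {S : Fin m → Finset (Fin m)}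
  {q : Player} {t : Player → Prop}

theorem WinsWithin.succ {n : ℕ} {p : Player} {u : V} (h : WinsWithin D S q t n p u) :
    WinsWithin D S q t (n + 1) p u := by
  induction n generalizing p u with
  | zero => exact h.elim
  | succ n ih =>
    rw [WinsWithin] at h ⊢
    split_ifs at h ⊢ with hp
    · exact h.imp_right fun ⟨w, hw, hw'⟩ => ⟨w, hw, ih hw'⟩
    · exact ⟨h.1, fun w hw => ih (h.2 w hw)⟩

theorem WinsWithin.mono {n k : ℕ} (hnk : n ≤ k) {p : Player} {u : V}
    (h : WinsWithin D S q t n p u) : WinsWithin D S q t k p u := by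
  induction hnk with
  | refl => exact h
  | step _ ih => exact ih.succ

variable (D S q t) in
/-- A positional strategy that always moves to a vertex of least rank. -/
theorem exists_rank_strategy : ∃ s : V → V, IsStrategy D S q s ∧
    ∀ n u, (∃ w, Permissible D S q u w ∧ WinsWithin D S q t n q.other w) →
      WinsWithin D S q t n q.other (s u) := by
  classical
  have key : ∀ u, ∃ v, ((∃ w, Permissible D S q u w) → Permissible D S q u v) ∧
      ∀ n, (∃ w, Permissible D S q u w ∧ WinsWithin D S q t n q.other w) →
        WinsWithin D S q t n q.other v := by
    intro u
    by_cases h : ∃ n w, Permissible D S q u w ∧ WinsWithin D S q t n q.other w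
    · obtain ⟨w, hw, hw'⟩ := Nat.find_spec h
      exact ⟨w, fun _ => hw, fun n hn => hw'.mono (Nat.find_min' h hn)⟩
    · by_cases h' : ∃ w, Permissible D S q u w
      · obtain ⟨w, hw⟩ := h'
        exact ⟨w, fun _ => hw, fun n hn => (h ⟨n, hn⟩).elim⟩
      · exact ⟨u, fun h'' => (h' h'').elim, fun n hn => (h ⟨n, hn⟩).elim⟩
  choose s hs hs' using key
  exact ⟨s, hs, fun n u => hs' u n⟩

/-- Every move lowers the available bound by one, by choice of `s` at the turns of `q` and for any
move at the opponent's turns. Bound `0` is impossible, so the play must stop earlier, at a player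
satisfying `t`. -/
theorem length_of_winsWithin {first : Player} {v₀ : V} {s : V → V} {len : ℕ∞} {pos : ℕ → V}
    (hs : ∀ n u, (∃ w, Permissible D S q u w ∧ WinsWithin D S q t n q.other w) →
      WinsWithin D S q t n q.other (s u))
    (hplay : IsPlay D S first v₀ len pos)
    (hfollow : ∀ k : ℕ, (k : ℕ∞) < len → mover first k = q → pos (k + 1) = s (pos k))
    (n k : ℕ) (hk : (k : ℕ∞) ≤ len) (h : WinsWithin D S q t n (mover first k) (pos k)) :
    ∃ N : ℕ, len = N ∧ t (mover first N) := by
  induction n generalizing k with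
  | zero => exact h.elim
  | succ n ih =>
    rw [WinsWithin] at h
    rcases hk.eq_or_lt with hk | hk
    · have hst := hplay.stuck k hk.symm
      refine ⟨k, hk.symm, ?_⟩
      split_ifs at h with hp
      · rcases h with h | ⟨w, hw, -⟩
        · exact h.2
        · exact (hst w hw).elim
      · exact h.1 hst
    · have hmove := hplay.step k hk
      refine ih (k + 1) ?_ ?_
      · rw [Nat.cast_add_one]; exact Order.add_one_le_of_lt hk
      rw [mover_succ]
      split_ifs at h with hp
      · rcases h with h | h
        · exact (h.1 _ hmove).elim
        · rw [hfollow k hk hp]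
          rw [hp] at h ⊢
          exact hs n _ h
      · exact h.2 _ hmove

/-- König's argument: from a position where no bound works, every move of `q` leads to another such
position, and by finite branching the opponent has a move that does so too. Following these moves
gives a play that `q` does not win. -/
theorem exists_play_avoiding {s : V → V} (hstrat : IsStrategy D S q s)
    (hfin : ∀ p u, {w | Permissible D S p u w}.Finite) {first : Player} {v₀ : V}
    (h₀ : ∀ n, ¬ WinsWithin D S q t n first v₀) :
    ∃ (len : ℕ∞) (pos : ℕ → V), IsPlay D S first v₀ len pos ∧
      (∀ k : ℕ, (k : ℕ∞) < len → mover first k = q → pos (k + 1) = s (pos k)) ∧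
      ∀ n : ℕ, len = n → ¬ t (mover first n) := by
  classical
  have key : ∀ p u, (∀ n, ¬ WinsWithin D S q t n p u) →
      ∃ v, ((∃ w, Permissible D S p u w) → Permissible D S p u v ∧
        (p = q → v = s u) ∧ ∀ n, ¬ WinsWithin D S q t n p.other v) := by
    intro p u hu
    by_cases hex : ∃ w, Permissible D S p u w
    swap
    · exact ⟨u, fun h => (hex h).elim⟩
    by_cases hp : p = q
    · subst hp
      refine ⟨s u, fun _ => ⟨hstrat u hex, fun _ => rfl, fun n hn => hu (n + 1) ?_⟩⟩
      rw [WinsWithin, if_pos rfl]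
      exact Or.inr ⟨_, hstrat u hex, hn⟩
    · by_contra! hcon
      have hall : ∀ w, ∃ n, Permissible D S p u w → WinsWithin D S q t n p.other w := by
        intro w
        by_cases hw : Permissible D S p u w
        · obtain ⟨n, hn⟩ := (hcon w).2 hw fun h => (hp h).elim
          exact ⟨n, fun _ => hn⟩
        · exact ⟨0, fun h => (hw h).elim⟩
      choose N hN using hall
      -- Finite branching enters here: if each reply had its own bound, the largest of them plus one
      -- would be a bound at `u`.
      obtain ⟨B, hB⟩ := ((hfin p u).image N).bddAbove
      refine hu (B + 1) ?_
      rw [WinsWithin, if_neg hp]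
      exact ⟨fun h => (hex.elim fun w hw => h w hw).elim, fun w hw =>
        (hN w hw).mono (hB ⟨w, hw, rfl⟩)⟩
  choose! next hnext using key
  let pos : ℕ → V := fun k => Nat.rec v₀ (fun k v => next (mover first k) v) k
  have pos_succ : ∀ k, pos (k + 1) = next (mover first k) (pos k) := fun k => rfl
  let stuck : ℕ → Prop := fun k => ∀ w, ¬ Permissible D S (mover first k) (pos k) w
  have avoid : ∀ k, (∀ i < k, ¬ stuck i) → ∀ n, ¬ WinsWithin D S q t n (mover first k) (pos k) := by
    intro k
    induction k with
    | zero => intro _; rw [mover_zero]; exact h₀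
    | succ k ih =>
      intro hk
      rw [mover_succ, pos_succ]
      have := hk k k.lt_succ_self
      simp only [stuck, not_forall, not_not] at this
      exact (hnext _ _ (ih fun i hi => hk i (hi.trans k.lt_succ_self)) this).2.2
  have move : ∀ k, (∀ i ≤ k, ¬ stuck i) →
      Permissible D S (mover first k) (pos k) (pos (k + 1)) ∧
        (mover first k = q → pos (k + 1) = s (pos k)) := by
    intro k hk
    have := hk k le_rfl
    simp only [stuck, not_forall, not_not] at this
    have := hnext _ _ (avoid k fun i hi => hk i hi.le) this
    exact ⟨this.1, this.2.1⟩
  by_cases hst : ∃ k, stuck k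
  · have hlt : ∀ k : ℕ, (k : ℕ∞) < (Nat.find hst : ℕ) → ∀ i ≤ k, ¬ stuck i := fun k hk i hi =>
      Nat.find_min hst (hi.trans_lt (Nat.cast_lt.1 hk))
    refine ⟨(Nat.find hst : ℕ), pos, ⟨rfl, fun k hk => (move k (hlt k hk)).1, ?_⟩,
      fun k hk => (move k (hlt k hk)).2, ?_⟩
    · intro n hn
      rw [← Nat.cast_inj.1 hn]
      exact Nat.find_spec hst
    · intro n hn ht
      rw [← Nat.cast_inj.1 hn] at ht
      -- A stuck position whose mover satisfies `t` is already won with bound `1`, the least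
      -- nontrivial bound.
      refine avoid _ (fun i hi => Nat.find_min hst hi) 1 ?_
      rw [WinsWithin]
      split_ifs
      · exact Or.inl ⟨Nat.find_spec hst, ht⟩
      · exact ⟨fun _ => ht, fun w hw => (Nat.find_spec hst w hw).elim⟩
  · push Not at hst
    exact ⟨⊤, pos, ⟨rfl, fun k _ => (move k fun i _ => hst i).1,
      fun n hn => (ENat.top_ne_natCast n hn).elim⟩, fun k _ => (move k fun i _ => hst i).2,
      fun n hn => (ENat.top_ne_natCast n hn).elim⟩

/-- In a locally finite graph, a player who can win by a finite play can do so within a bounded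
number of moves. -/
theorem hasWinningStrategy_iff {g : Game} {first : Player} {v₀ : V}
    (hg : ∀ len : ℕ∞, WinsPlay g first q len ↔ ∃ n : ℕ, len = n ∧ t (mover first n))
    (hfin : ∀ p u, {w | Permissible D S p u w}.Finite) :
    HasWinningStrategy D S g first q v₀ ↔ ∃ n, WinsWithin D S q t n first v₀ := by
  constructor
  · rintro ⟨s, hs, hwin⟩
    by_contra! hcon
    obtain ⟨len, pos, hplay, hfollow, hlose⟩ := exists_play_avoiding hs hfin hcon
    obtain ⟨n, hn, hn'⟩ := (hg len).1 (hwin len pos hplay hfollow)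
    exact hlose n hn hn'
  · rintro ⟨n, hn⟩
    obtain ⟨s, hs, hs'⟩ := exists_rank_strategy D S q t
    refine ⟨s, hs, fun len pos hplay hfollow => (hg len).2 ?_⟩
    refine length_of_winsWithin hs' hplay hfollow n 0 zero_le ?_
    rwa [mover_zero, hplay.start]

end Graph

/-- This and the next two statements put the games into the form required by
`hasWinningStrategy_iff`. -/
theorem winsPlay_normal_iff (first q : Player) (len : ℕ∞) :
    WinsPlay .normal first q len ↔ ∃ n : ℕ, len = n ∧ mover first n ≠ q := by
  simp only [WinsPlay]
  refine exists_congr fun n => and_congr_right fun _ => ⟨fun h => ?_, Player.eq_other_of_ne⟩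
  rw [h]; exact q.other_ne

theorem winsPlay_misere_iff (first q : Player) (len : ℕ∞) :
    WinsPlay .misere first q len ↔ ∃ n : ℕ, len = n ∧ mover first n = q := Iff.rfl

theorem winsPlay_escape_iff (first : Player) (len : ℕ∞) :
    WinsPlay .escape first .P1 len ↔ ∃ n : ℕ, len = n ∧ True := by
  simp [WinsPlay, ENat.ne_top_iff_exists, eq_comm]

/-! ### Winning sets in the tree -/

section Tree

variable {m : ℕ}

/-- The offspring vectors in the subtree of the child `p` of the root. -/
def subtree (p : Fin m × ℕ) (X : Node m → Fin m → ℕ) : Node m → Fin m → ℕ := fun u => X (u ++ [p])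

/-- Every child of the root with colour in `A` is the root of a subtree in the class prescribed
for its colour. -/
def childrenIn (A : Finset (Fin m)) (E : Fin m → Set (Node m → Fin m → ℕ)) :
    Set (Node m → Fin m → ℕ) :=
  {X | ∀ c ∈ A, ∀ a < X [] c, subtree (c, a) X ∈ E c}

open Classical in
/-- The offspring vectors for which `q` wins within a bounded number of moves, in terms of the
number of moves, the player to move and the colour of the root. -/
def winSet (S : Fin m → Finset (Fin m)) (q : Player) (t : Player → Prop) :
    ℕ → Player → Fin m → Set (Node m → Fin m → ℕ)
  | 0, _, _ => ∅
  | n + 1, p, j =>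
    if p = q then
      (childrenIn (moveSet S p j) fun c => (winSet S q t n p.other c)ᶜ)ᶜ ∪
        {X | X ∈ childrenIn (moveSet S p j) (fun _ => ∅) ∧ t p}
    else
      childrenIn (moveSet S p j) (fun c => winSet S q t n p.other c) \
        {X | X ∈ childrenIn (moveSet S p j) (fun _ => ∅) ∧ ¬ t p}

theorem nodeColour_append (j : Fin m) (u : Node m) (p : Fin m × ℕ) :
    nodeColour j (u ++ [p]) = nodeColour p.1 u := by
  cases u <;> rfl

theorem permissible_tree_iff {S : Fin m → Finset (Fin m)} {p : Player} {j : Fin m}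
    {X : Node m → Fin m → ℕ} {u w : Node m} :
    Permissible (Realization.tree (j, X)) S p u w ↔
      ∃ c ∈ moveSet S p (nodeColour j u), ∃ a < X u c, w = (c, a) :: u := by
  simp only [Permissible, Realization.tree]
  constructor
  · rintro ⟨⟨c, a, ha, rfl⟩, hc⟩
    exact ⟨c, hc, a, ha, rfl⟩
  · rintro ⟨c, hc, a, ha, rfl⟩
    exact ⟨⟨c, a, ha, rfl⟩, hc⟩

theorem finite_permissible_tree (S : Fin m → Finset (Fin m)) (p : Player) (T : Realization m)
    (u : Node m) : {w | Permissible T.tree S p u w}.Finite := by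
  have : {w | Permissible T.tree S p u w} ⊆
      ⋃ c : Fin m, (fun a => (c, a) :: u) '' Set.Iio (T.2 u c) := by
    intro w hw
    obtain ⟨c, -, a, ha, rfl⟩ := permissible_tree_iff.1 hw
    exact Set.mem_iUnion.2 ⟨c, a, ha, rfl⟩
  exact (Set.finite_iUnion fun c => (Set.finite_Iio _).image _).subset this

theorem permissible_subtree_iff {S : Fin m → Finset (Fin m)} {p : Player} {j : Fin m}
    {X : Node m → Fin m → ℕ} {u w : Node m} {x : Fin m × ℕ} :
    Permissible (Realization.tree (j, X)) S p (u ++ [x]) w ↔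
      ∃ w', w = w' ++ [x] ∧ Permissible (Realization.tree (x.1, subtree x X)) S p u w' := by
  simp only [permissible_tree_iff, nodeColour_append]
  constructor
  · rintro ⟨c, hc, a, ha, rfl⟩
    exact ⟨(c, a) :: u, rfl, c, hc, a, ha, rfl⟩
  · rintro ⟨_, rfl, c, hc, a, ha, rfl⟩
    exact ⟨c, hc, a, ha, rfl⟩

/-- Names list the path from a vertex back towards the root, so the descendants of the child `x` of
the root are the names `u ++ [x]`, and dropping `x` identifies the game below `x` with a game from a
root. -/
theorem winsWithin_subtree {S : Fin m → Finset (Fin m)} {q : Player} {t : Player → Prop}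
    {j : Fin m} {X : Node m → Fin m → ℕ} {x : Fin m × ℕ} {n : ℕ} {p : Player} {u : Node m} :
    WinsWithin (Realization.tree (j, X)) S q t n p (u ++ [x]) ↔
      WinsWithin (Realization.tree (x.1, subtree x X)) S q t n p u := by
  induction n generalizing p u with
  | zero => rfl
  | succ n ih =>
    simp only [WinsWithin, permissible_subtree_iff]
    have h1 : (∀ w, ¬ ∃ w', w = w' ++ [x] ∧
        Permissible (Realization.tree (x.1, subtree x X)) S p u w') ↔
        ∀ w, ¬ Permissible (Realization.tree (x.1, subtree x X)) S p u w :=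
      ⟨fun h w hw => h _ ⟨w, rfl, hw⟩, fun h w ⟨w', _, hw⟩ => h w' hw⟩
    have h2 : (∃ w, (∃ w', w = w' ++ [x] ∧
        Permissible (Realization.tree (x.1, subtree x X)) S p u w') ∧
        WinsWithin (Realization.tree (j, X)) S q t n p.other w) ↔
        ∃ w, Permissible (Realization.tree (x.1, subtree x X)) S p u w ∧
          WinsWithin (Realization.tree (x.1, subtree x X)) S q t n p.other w :=
      ⟨fun ⟨_, ⟨w', hw, h⟩, h'⟩ => ⟨w', h, ih.1 (hw ▸ h')⟩,
        fun ⟨w, h, h'⟩ => ⟨_, ⟨w, rfl, h⟩, ih.2 h'⟩⟩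
    have h3 : (∀ w, (∃ w', w = w' ++ [x] ∧
        Permissible (Realization.tree (x.1, subtree x X)) S p u w') →
        WinsWithin (Realization.tree (j, X)) S q t n p.other w) ↔
        ∀ w, Permissible (Realization.tree (x.1, subtree x X)) S p u w →
          WinsWithin (Realization.tree (x.1, subtree x X)) S q t n p.other w :=
      ⟨fun h w hw => ih.1 (h _ ⟨w, rfl, hw⟩), fun h w ⟨w', hw, h'⟩ => hw ▸ ih.2 (h w' h')⟩
    rw [h1, h2, h3]

/-- A good move exists iff not all moves are bad; hence both turns reduce to `childrenIn`, whose
probability is a generating function. -/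
theorem winsWithin_tree_iff {S : Fin m → Finset (Fin m)} {q : Player} {t : Player → Prop}
    {j : Fin m} {X : Node m → Fin m → ℕ} {n : ℕ} {p : Player} :
    WinsWithin (Realization.tree (j, X)) S q t n p [] ↔ X ∈ winSet S q t n p j := by
  induction n generalizing p j X with
  | zero => simp [WinsWithin, winSet]
  | succ n ih =>
    have hsub : ∀ (c : Fin m) (a : ℕ), WinsWithin (Realization.tree (j, X)) S q t n p.other
        [(c, a)] ↔ subtree (c, a) X ∈ winSet S q t n p.other c := fun c a =>
      (winsWithin_subtree (u := []) (x := (c, a))).trans ih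
    have h1 : (∀ w, ¬ Permissible (Realization.tree (j, X)) S p [] w) ↔
        X ∈ childrenIn (moveSet S p j) (fun _ => ∅) := by
      simp only [permissible_tree_iff, childrenIn, Set.mem_ofPred_eq, nodeColour]
      exact ⟨fun h c hc a ha => h _ ⟨c, hc, a, ha, rfl⟩,
        fun h w ⟨c, hc, a, ha, _⟩ => h c hc a ha⟩
    have h3 : ∀ Q : Node m → Prop, (∀ w, Permissible (Realization.tree (j, X)) S p [] w → Q w) ↔
        ∀ c ∈ moveSet S p j, ∀ a < X [] c, Q [(c, a)] := by
      intro Q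
      simp only [permissible_tree_iff, nodeColour]
      exact ⟨fun h c hc a ha => h _ ⟨c, hc, a, ha, rfl⟩,
        fun h w ⟨c, hc, a, ha, e⟩ => e ▸ h c hc a ha⟩
    have h2 : (∃ w, Permissible (Realization.tree (j, X)) S p [] w ∧
        WinsWithin (Realization.tree (j, X)) S q t n p.other w) ↔
        X ∉ childrenIn (moveSet S p j) fun c => (winSet S q t n p.other c)ᶜ := by
      rw [← not_iff_not, not_not]
      push Not
      rw [h3]
      simp only [hsub, childrenIn, Set.mem_ofPred_eq, Set.mem_compl_iff]
    rw [WinsWithin, winSet]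
    split_ifs with hp
    · rw [h1, h2, or_comm]
      rfl
    · rw [h1, h3]
      simp only [hsub]
      rw [Set.mem_sdiff, Set.mem_ofPred_eq, not_and_not_right, and_comm]
      rfl

theorem winSet_mono (S : Fin m → Finset (Fin m)) (q : Player) (t : Player → Prop) (p : Player)
    (j : Fin m) : Monotone fun n => winSet S q t n p j := by
  intro n k hnk X hX
  exact winsWithin_tree_iff.1 ((winsWithin_tree_iff.2 hX).mono hnk)

end Tree

/-! ### The branching property -/

/-- A finite box pulls back to a box over the image coordinates. The default value of
`Function.extend` is never seen. -/
theorem infinitePi_map_comp_injective {ι κ Y : Type*} [MeasurableSpace Y] (μ : κ → Measure Y)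
    [∀ k, IsProbabilityMeasure (μ k)] {e : ι → κ} (he : Function.Injective e) :
    (Measure.infinitePi μ).map (fun x i => x (e i)) = Measure.infinitePi fun i => μ (e i) := by
  classical
  refine Measure.eq_infinitePi _ fun s t ht => ?_
  rw [Measure.map_apply (by fun_prop) (.pi s.countable_toSet fun _ _ => ht _)]
  have : (fun (x : κ → Y) i => x (e i)) ⁻¹' Set.pi s t =
      Set.pi (s.map ⟨e, he⟩ : Finset κ) (Function.extend e t fun _ => Set.univ) := by
    ext x
    simp [Set.mem_pi, he.extend_apply]
  rw [this, Measure.infinitePi_pi]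
  · simp [he.extend_apply]
  · intro k hk
    obtain ⟨i, -, rfl⟩ := Finset.mem_map.1 hk
    simpa [he.extend_apply] using ht i

section Branching

variable {m : ℕ} (χ : Fin m → PMF (Fin m → ℕ))

/-- The law of the offspring vectors if the root has colour `j`. -/
noncomputable def offspringLaw (j : Fin m) : Measure (Node m → Fin m → ℕ) :=
  Measure.infinitePi fun v : Node m => (χ (nodeColour j v)).toMeasure

instance (j : Fin m) : IsProbabilityMeasure (offspringLaw χ j) := by
  unfold offspringLaw; infer_instance

/-- Laws of the offspring vectors of the root (`none`) and in the subtrees of potential children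
of the root. -/
noncomputable def splitLaw (j : Fin m) : Option (Fin m × ℕ) → Node m → Measure (Fin m → ℕ)
  | none, _ => (χ j).toMeasure
  | some p, v => (χ (nodeColour p.1 v)).toMeasure

instance (j : Fin m) (o : Option (Fin m × ℕ)) (v : Node m) :
    IsProbabilityMeasure (splitLaw χ j o v) := by
  cases o <;> unfold splitLaw <;> infer_instance

/-- A node is determined by the child of the root it descends from (`none` for the root itself) and
its name below that child. This exhibits the offspring vectors as independent blocks. The reindexing
is only injective, since the block `none` has unused coordinates. -/
theorem map_splitLaw (j : Fin m) :
    (Measure.infinitePi fun o => Measure.infinitePi fun v => splitLaw χ j o v).map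
      (fun Y (u : Node m) => Y u.getLast? u.dropLast) = offspringLaw χ j := by
  have hinj : Function.Injective fun u : Node m => (u.getLast?, u.dropLast) := by
    intro u v h
    rcases List.eq_nil_or_concat u with rfl | ⟨u', p, rfl⟩ <;>
      rcases List.eq_nil_or_concat v with rfl | ⟨v', p', rfl⟩ <;> simp_all
  have h := infinitePi_map_comp_injective
    (fun p : Option (Fin m × ℕ) × Node m => splitLaw χ j p.1 p.2) hinj
  rw [← Measure.infinitePi_map_curry_symm, Measure.map_map (by fun_prop) (by fun_prop)] at h
  refine Eq.trans h ?_
  unfold offspringLaw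
  congr 1
  funext u
  rcases List.eq_nil_or_concat u with rfl | ⟨u', p, rfl⟩
  · rfl
  · simp [splitLaw, nodeColour_append]

theorem measurable_root : Measurable fun X : Node m → Fin m → ℕ => X [] := by fun_prop

theorem measurable_subtree (p : Fin m × ℕ) : Measurable (subtree p) := by
  unfold subtree; fun_prop

theorem measurableSet_childrenIn (A : Finset (Fin m)) {E : Fin m → Set (Node m → Fin m → ℕ)}
    (hE : ∀ c, MeasurableSet (E c)) : MeasurableSet (childrenIn A E) := by
  have : childrenIn A E = ⋂ c ∈ A, ⋂ a : ℕ, {X | X [] c ≤ a} ∪ subtree (c, a) ⁻¹' E c := by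
    ext X
    simp only [childrenIn, Set.mem_ofPred_eq, Set.mem_iInter, Set.mem_union, Set.mem_preimage]
    exact forall₂_congr fun c _ => forall_congr' fun a => by rw [← not_lt, imp_iff_not_or]
  rw [this]
  refine Finset.measurableSet_biInter _ fun c _ => MeasurableSet.iInter fun a =>
    MeasurableSet.union ?_ (measurable_subtree _ (hE c))
  exact measurableSet_le (by fun_prop) measurable_const

theorem measurableSet_winSet (S : Fin m → Finset (Fin m)) (q : Player) (t : Player → Prop)
    (n : ℕ) (p : Player) (j : Fin m) : MeasurableSet (winSet S q t n p j) := by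
  induction n generalizing p j with
  | zero => exact MeasurableSet.empty
  | succ n ih =>
    have h0 := measurableSet_childrenIn (m := m) (moveSet S p j) (E := fun _ => ∅)
      fun _ => MeasurableSet.empty
    rw [winSet]
    split_ifs
    · exact (measurableSet_childrenIn _ fun c => (ih _ c).compl).compl.union
        (h0.inter (MeasurableSet.const _))
    · exact (measurableSet_childrenIn _ fun c => ih _ c).diff (h0.inter (MeasurableSet.const _))

theorem marginal_apply (j : Fin m) (A : Finset (Fin m)) (k : A → ℕ) :
    marginal χ j A k = (χ j).toMeasure {n | ∀ c : A, n c = k c} := by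
  rw [← PMF.toMeasure_apply_singleton _ k (measurableSet_singleton k), marginal,
    PMF.toMeasure_map_apply _ _ _ (by fun_prop) (measurableSet_singleton k)]
  congr 1
  ext n
  simp [funext_iff]

/-- Once the root's offspring numbers `k` are fixed, the event constrains finitely many independent
blocks: the root and one subtree per existing child. -/
theorem measure_rootOffspring_inter_childrenIn (j : Fin m) (A : Finset (Fin m))
    {E : Fin m → Set (Node m → Fin m → ℕ)} (hE : ∀ c, MeasurableSet (E c)) (k : A → ℕ) :
    offspringLaw χ j ({X | ∀ c : A, X [] c = k c} ∩ childrenIn A E) =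
      (∏ c : A, offspringLaw χ c (E c) ^ k c) * marginal χ j A k := by
  classical
  have hroot : MeasurableSet {n : Fin m → ℕ | ∀ c : A, n c = k c} := 
    (Set.to_countable _).measurableSet
  have hroot' : MeasurableSet {X : Node m → Fin m → ℕ | ∀ c : A, X [] c = k c} :=
    measurable_root hroot
  -- The children of the root with colours in `A` that exist when the offspring numbers are `k`.
  let s : Finset (Fin m × ℕ) :=
    (Finset.univ : Finset A).biUnion fun c => (Finset.range (k c)).map
      ⟨fun a => (c.1, a), fun _ _ h => (Prod.ext_iff.1 h).2⟩
  let t : Option (Fin m × ℕ) → Set (Node m → Fin m → ℕ)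
    | none => {X | ∀ c : A, X [] c = k c}
    | some p => E p.1
  have ht : ∀ o, MeasurableSet (t o)
    | none => hroot'
    | some p => hE p.1
  have hpre : (fun (Y : Option (Fin m × ℕ) → Node m → Fin m → ℕ) (u : Node m) =>
      Y u.getLast? u.dropLast) ⁻¹' ({X | ∀ c : A, X [] c = k c} ∩ childrenIn A E) =
      Set.pi (Finset.insertNone s : Finset _) t := by
    ext Y
    have hsub : ∀ p, subtree p (fun u : Node m => Y u.getLast? u.dropLast) = Y (some p) := by
      intro p; funext u; simp [subtree]
    simp only [Set.mem_preimage, Set.mem_inter_iff, childrenIn, Set.mem_ofPred_eq, hsub,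
      Set.mem_pi, Finset.mem_coe, Option.forall, t, Finset.some_mem_insertNone,
      Finset.none_mem_insertNone, true_imp_iff, List.getLast?_nil, List.dropLast_nil]
    refine and_congr_right fun h => ?_
    simp only [s, Finset.mem_biUnion, Finset.mem_univ, true_and, Finset.mem_map,
      Finset.mem_range]
    constructor
    · rintro hY p ⟨c, a, ha, rfl⟩
      exact hY c c.2 a ((h c).symm ▸ ha)
    · intro hY c hc a ha
      exact hY (c, a) ⟨⟨c, hc⟩, a, (h ⟨c, hc⟩) ▸ ha, rfl⟩
  rw [← map_splitLaw, Measure.map_apply (by fun_prop)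
    (hroot'.inter (measurableSet_childrenIn A hE)), hpre, Measure.infinitePi_pi _ fun o _ => ht o,
    Finset.prod_insertNone, mul_comm]
  congr 1
  · simp only [s]
    rw [Finset.prod_biUnion]
    · refine Finset.prod_congr rfl fun c _ => ?_
      rw [Finset.prod_map]
      refine (Finset.prod_congr rfl (g := fun _ => offspringLaw χ c (E c)) fun a _ => rfl).trans ?_
      rw [Finset.prod_const, Finset.card_range]
    · intro c _ c' _ hcc'
      refine Finset.disjoint_left.2 fun p hp hp' => hcc' ?_
      obtain ⟨a, -, rfl⟩ := Finset.mem_map.1 hp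
      obtain ⟨a', -, h⟩ := Finset.mem_map.1 hp'
      exact Subtype.ext (Prod.ext_iff.1 h).1.symm
  · rw [marginal_apply]
    exact (measurePreserving_eval_infinitePi (fun v : Node m => splitLaw χ j none v)
      ([] : Node m)).measure_preimage hroot.nullMeasurableSet

/-- Summing over the possible offspring vectors of the root produces the generating function series.
-/
theorem real_childrenIn (j : Fin m) (A : Finset (Fin m))
    {E : Fin m → Set (Node m → Fin m → ℕ)} (hE : ∀ c, MeasurableSet (E c)) :
    (offspringLaw χ j).real (childrenIn A E) =
      pgf χ j A fun c => (offspringLaw χ c).real (E c) := by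
  have hun : childrenIn A E =
      ⋃ k : A → ℕ, {X | ∀ c : A, X [] c = k c} ∩ childrenIn A E := by
    ext X
    simp only [Set.mem_iUnion, Set.mem_inter_iff, Set.mem_ofPred_eq, exists_and_right]
    exact ⟨fun h => ⟨⟨fun c => X [] c, fun _ => rfl⟩, h⟩, fun h => h.2⟩
  rw [Measure.real, hun, measure_iUnion, ENNReal.tsum_toReal_eq (fun k => measure_ne_top _ _), pgf]
  · refine tsum_congr fun k => ?_
    rw [measure_rootOffspring_inter_childrenIn χ j A hE, ENNReal.toReal_mul, ENNReal.toReal_prod]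
    simp [Measure.real]
  · intro k k' hkk'
    refine Set.disjoint_left.2 fun X hX hX' => hkk' (funext fun c => ?_)
    rw [← hX.1 c, ← hX'.1 c]
  · intro k
    exact (measurable_root
      (Set.to_countable {n : Fin m → ℕ | ∀ c : A, n c = k c}).measurableSet).inter
        (measurableSet_childrenIn A hE)

theorem real_childrenIn_empty (j : Fin m) (A : Finset (Fin m)) :
    (offspringLaw χ j).real (childrenIn A fun _ => ∅) = noChildProb χ j A := by
  have h : childrenIn A (fun _ => ∅) =
      Function.eval ([] : Node m) ⁻¹' {n : Fin m → ℕ | ∀ k ∈ A, n k = 0} := by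
    ext X
    simp only [childrenIn, Set.mem_ofPred_eq, Set.mem_empty_iff_false, Set.mem_preimage,
      Function.eval]
    exact forall₂_congr fun c _ =>
      ⟨fun h => Nat.eq_zero_of_not_pos fun hp => h 0 hp, fun h a ha => by omega⟩
  have hm := measurePreserving_eval_infinitePi
    (fun v : Node m => (χ (nodeColour j v)).toMeasure) ([] : Node m)
  rw [h, noChildProb, Measure.real, Measure.real, offspringLaw,
    hm.measure_preimage (Set.to_countable _).measurableSet.nullMeasurableSet]
  rfl

end Branching

/-! ### Probability generating functions on the cube -/

/-! ### Inequalities and convexity for single monomials -/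

section Monomials

variable {ι : Type*} [Fintype ι]

theorem monomial_mem_Icc {x : ι → ℝ} (hx : x ∈ Set.Icc 0 1) (k : ι → ℕ) :
    ∏ i, x i ^ k i ∈ Set.Icc (0 : ℝ) 1 :=
  ⟨Finset.prod_nonneg fun i _ => pow_nonneg (hx.1 i) _,
    Finset.prod_le_one (fun i _ => pow_nonneg (hx.1 i) _)
      fun i _ => pow_le_one₀ (hx.1 i) (hx.2 i)⟩

theorem monomial_mono {x y : ι → ℝ} (hx : 0 ≤ x) (hxy : x ≤ y) (k : ι → ℕ) :
    ∏ i, x i ^ k i ≤ ∏ i, y i ^ k i :=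
  Finset.prod_le_prod (fun i _ => pow_nonneg (hx i) _)
    fun i _ => pow_le_pow_left₀ (hx i) (hxy i) _

/-- A monomial of degree one gains at least `b i`; for all others monotonicity suffices. -/
theorem monomial_add_le [DecidableEq ι] {u b y : ι → ℝ} (hu : 0 ≤ u) (hb : 0 ≤ b) (huy : u + b ≤ y)
    (k : ι → ℕ) :
    ∏ i, u i ^ k i + ∑ i, b i * (if k = Pi.single i 1 then 1 else 0) ≤ ∏ i, y i ^ k i := by
  by_cases hk : ∃ i, k = Pi.single i 1
  · obtain ⟨i, rfl⟩ := hk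
    have hprod : ∀ x : ι → ℝ, ∏ l, x l ^ (Pi.single i 1 : ι → ℕ) l = x i := by
      intro x
      rw [Finset.prod_eq_single i] <;> simp +contextual
    have hsum : ∑ l, b l * (if (Pi.single i 1 : ι → ℕ) = Pi.single l 1 then 1 else 0) = b i := by
      rw [Finset.sum_eq_single i]
      · simp
      · intro l _ hl
        rw [if_neg, mul_zero]
        intro h
        have := congrFun h i
        simp [hl.symm] at this
      · simp
    rw [hprod, hprod, hsum]
    exact huy i
  · push Not at hk
    simp only [hk, if_false, mul_zero, Finset.sum_const_zero, add_zero]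
    exact monomial_mono hu (fun i => (le_add_of_nonneg_right (hb i)).trans (huy i)) k

/-- One-sided form of the fact that `x ^ n` is `n`-Lipschitz on the unit interval. -/
theorem pow_sub_pow_le {a b β : ℝ} (ha : a ∈ Set.Icc (0 : ℝ) 1) (hb : b ∈ Set.Icc (0 : ℝ) 1)
    (hβ : 0 ≤ β) (hab : a ≤ b + β) (n : ℕ) : a ^ n ≤ b ^ n + β * n := by
  induction n with
  | zero => simp
  | succ n ih =>
    have h1 := pow_le_one₀ (n := n) ha.1 ha.2
    have h2 := pow_le_one₀ (n := n) hb.1 hb.2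
    have h3 : 0 ≤ b ^ n := pow_nonneg hb.1 n
    have h4 : 0 ≤ a ^ n := pow_nonneg ha.1 n
    have h5 : 0 ≤ β * n := by positivity
    rw [pow_succ, pow_succ]
    push_cast
    nlinarith [mul_le_mul_of_nonneg_left hab h4, mul_le_mul_of_nonneg_right ih hb.1,
      mul_le_mul_of_nonneg_left hb.2 h5, mul_le_mul_of_nonneg_right h1 hβ]

omit [Fintype ι] in
theorem prod_le_prod_add_sum (s : Finset ι) {f g d : ι → ℝ}
    (hf : ∀ i, f i ∈ Set.Icc (0 : ℝ) 1) (hg : ∀ i, g i ∈ Set.Icc (0 : ℝ) 1)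
    (hd : 0 ≤ d) (h : ∀ i, f i ≤ g i + d i) :
    ∏ i ∈ s, f i ≤ ∏ i ∈ s, g i + ∑ i ∈ s, d i := by
  classical
  induction s using Finset.induction_on with
  | empty => simp
  | insert i s hi ih =>
    rw [Finset.prod_insert hi, Finset.prod_insert hi, Finset.sum_insert hi]
    have h1 : ∏ i ∈ s, f i ≤ 1 := Finset.prod_le_one (fun i _ => (hf i).1) fun i _ => (hf i).2
    have h2 : 0 ≤ ∏ i ∈ s, f i := Finset.prod_nonneg fun i _ => (hf i).1
    have h3 : 0 ≤ ∑ i ∈ s, d i := Finset.sum_nonneg fun i _ => hd i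
    nlinarith [mul_le_mul_of_nonneg_right (h i) h2, mul_le_mul_of_nonneg_left ih (hg i).1,
      mul_le_mul_of_nonneg_left h1 (hd i), mul_le_mul_of_nonneg_right (hg i).2 h3]

theorem monomial_le_add {a b β : ι → ℝ} (ha : a ∈ Set.Icc 0 1) (hb : b ∈ Set.Icc 0 1)
    (hβ : 0 ≤ β) (hab : a ≤ b + β) (k : ι → ℕ) :
    ∏ i, a i ^ k i ≤ ∏ i, b i ^ k i + ∑ i, β i * k i :=
  prod_le_prod_add_sum _
    (fun i => ⟨pow_nonneg (ha.1 i) _, pow_le_one₀ (ha.1 i) (ha.2 i)⟩)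
    (fun i => ⟨pow_nonneg (hb.1 i) _, pow_le_one₀ (hb.1 i) (hb.2 i)⟩)
    (fun i => mul_nonneg (hβ i) (Nat.cast_nonneg _))
    fun i => pow_sub_pow_le ⟨ha.1 i, ha.2 i⟩ ⟨hb.1 i, hb.2 i⟩ (hβ i) (hab i) _

omit [Fintype ι] in
theorem convexOn_prod_of_monotoneOn {s : Set ℝ} (hs : Convex ℝ s) (I : Finset ι) {f : ι → ℝ → ℝ}
    (hc : ∀ i, ConvexOn ℝ s (f i)) (hm : ∀ i, MonotoneOn (f i) s)
    (h0 : ∀ i, ∀ r ∈ s, 0 ≤ f i r) : ConvexOn ℝ s fun r => ∏ i ∈ I, f i r := by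
  classical
  induction I using Finset.induction_on with
  | empty => simpa using convexOn_const 1 hs
  | insert i I hi ih =>
    simp only [Finset.prod_insert hi]
    refine (hc i).mul ih (h0 i) (fun r hr => Finset.prod_nonneg fun l _ => h0 l r hr) ?_
    refine (hm i).monovaryOn fun r hr r' hr' h => ?_
    exact Finset.prod_le_prod (fun l _ => h0 l r hr) fun l _ => hm l hr hr' h

/-- In a nonnegative direction all factors are nonnegative, increasing and convex, and such products
are convex. In a general direction this fails, for instance for `x * y`. -/
theorem convexOn_monomial_line {x d : ι → ℝ} (hx : 0 ≤ x) (hd : 0 ≤ d) (k : ι → ℕ) :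
    ConvexOn ℝ (Set.Icc 0 1) fun r : ℝ => ∏ i, (x + r • d) i ^ k i := by
  have hnn : ∀ i, ∀ r ∈ Set.Icc (0 : ℝ) 1, 0 ≤ x i + r * d i := fun i r hr =>
    add_nonneg (hx i) (mul_nonneg hr.1 (hd i))
  refine convexOn_prod_of_monotoneOn (convex_Icc 0 1) _ (fun i => ?_) (fun i r hr r' _ h => ?_)
    fun i r hr => pow_nonneg (hnn i r hr) _
  · refine ConvexOn.pow (f := fun r => x i + r * d i) ⟨convex_Icc 0 1, ?_⟩ (hnn i) _
    intro r _ r' _ a b _ _ hab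
    simp only [smul_eq_mul]
    apply le_of_eq
    linear_combination (-x i) * hab
  · exact pow_le_pow_left₀ (hnn i r hr)
      (add_le_add_right (mul_le_mul_of_nonneg_right h (hd i)) _) _

end Monomials

/-! ### Convexity, tangents and comparison estimates for generating functions -/

section Pgf

variable {m : ℕ} (χ : Fin m → PMF (Fin m → ℕ)) (j : Fin m) {A : Finset (Fin m)}

theorem summable_marginal : Summable fun k => (marginal χ j A k).toReal :=
  ENNReal.summable_toReal (PMF.tsum_coe_ne_top _)

theorem tsum_marginal : ∑' k, (marginal χ j A k).toReal = 1 := by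
  rw [← ENNReal.tsum_toReal_eq (fun k => PMF.apply_ne_top _ k), PMF.tsum_coe, ENNReal.toReal_one]

theorem summable_pgf {x : A → ℝ} (hx : x ∈ Set.Icc 0 1) :
    Summable fun k : A → ℕ => (∏ i, x i ^ k i) * (marginal χ j A k).toReal :=
  (summable_marginal χ j).of_nonneg_of_le
    (fun k => mul_nonneg (monomial_mem_Icc hx k).1 ENNReal.toReal_nonneg)
    fun k => mul_le_of_le_one_left ENNReal.toReal_nonneg (monomial_mem_Icc hx k).2

theorem pgf_mono {x y : A → ℝ} (hx : 0 ≤ x) (hxy : x ≤ y) (hy : y ≤ 1) :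
    pgf χ j A x ≤ pgf χ j A y :=
  (summable_pgf χ j ⟨hx, hxy.trans hy⟩).tsum_le_tsum
    (fun k => mul_le_mul_of_nonneg_right (monomial_mono hx hxy k) ENNReal.toReal_nonneg)
    (summable_pgf χ j ⟨hx.trans hxy, hy⟩)

theorem pgf_le_one {x : A → ℝ} (hx : x ∈ Set.Icc 0 1) : pgf χ j A x ≤ 1 := by
  rw [← tsum_marginal χ j (A := A)]
  exact (summable_pgf χ j hx).tsum_le_tsum
    (fun k => mul_le_of_le_one_left ENNReal.toReal_nonneg (monomial_mem_Icc hx k).2)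
    (summable_marginal χ j)

theorem continuousOn_pgf : ContinuousOn (pgf χ j A) (Set.Icc 0 1) := by
  refine continuousOn_tsum (fun k => by fun_prop) (summable_marginal χ j) fun k x hx => ?_
  rw [Real.norm_of_nonneg (mul_nonneg (monomial_mem_Icc hx k).1 ENNReal.toReal_nonneg)]
  exact mul_le_of_le_one_left ENNReal.toReal_nonneg (monomial_mem_Icc hx k).2

theorem convexOn_pgf_line {x d : A → ℝ} (hx : 0 ≤ x) (hd : 0 ≤ d) (hxd : x + d ≤ 1) :
    ConvexOn ℝ (Set.Icc 0 1) fun r : ℝ => pgf χ j A (x + r • d) := by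
  have hmem : ∀ r ∈ Set.Icc (0 : ℝ) 1, x + r • d ∈ Set.Icc (0 : A → ℝ) 1 := fun r hr =>
    ⟨add_nonneg hx (smul_nonneg hr.1 hd), fun i => (add_le_add_right
      (mul_le_of_le_one_left (hd i) hr.2) _).trans (hxd i)⟩
  refine ⟨convex_Icc 0 1, fun r hr r' hr' a b ha hb hab => ?_⟩
  simp only [smul_eq_mul, pgf]
  have h1 := summable_pgf χ j (hmem r hr)
  have h2 := summable_pgf χ j (hmem r' hr')
  rw [← tsum_mul_left, ← tsum_mul_left, ← (h1.mul_left a).tsum_add (h2.mul_left b)]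
  refine (summable_pgf χ j (hmem _ (convex_Icc 0 1 hr hr' ha hb hab))).tsum_le_tsum
    (fun k => ?_) ((h1.mul_left a).add (h2.mul_left b))
  have := mul_le_mul_of_nonneg_right ((convexOn_monomial_line hx hd k).2 hr hr' ha hb hab)
    (ENNReal.toReal_nonneg (a := marginal χ j A k))
  simp only [smul_eq_mul] at this ⊢
  linarith

theorem partialDeriv_eq_fderivWithin {x : A → ℝ} (hx : x ∈ Set.Icc 0 1)
    (hd : DifferentiableWithinAt ℝ (pgf χ j A) (Set.Icc 0 1) x) (i : A) :
    partialDeriv (pgf χ j A) i x =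
      fderivWithin ℝ (pgf χ j A) (Set.Icc 0 1) x (Pi.single i 1) := by
  have hmaps : Set.MapsTo (Function.update x i) (Set.Icc 0 1) (Set.Icc 0 1) := by
    intro r hr
    refine ⟨le_update_iff.2 ⟨hr.1, fun l _ => hx.1 l⟩,
      update_le_iff.2 ⟨hr.2, fun l _ => hx.2 l⟩⟩
  have h1 : HasFDerivWithinAt (pgf χ j A) (fderivWithin ℝ (pgf χ j A) (Set.Icc 0 1) x)
      (Set.Icc 0 1) (Function.update x i (x i)) := by
    rw [Function.update_eq_self]; exact hd.hasFDerivWithinAt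
  exact (h1.comp_hasDerivWithinAt (x i) (hasDerivAt_update x i (x i)).hasDerivWithinAt
    hmaps).derivWithin (uniqueDiffOn_Icc zero_lt_one _ ⟨hx.1 i, hx.2 i⟩)

theorem partialDeriv_pgf_nonneg {x : A → ℝ} (hx : x ∈ Set.Icc 0 1) (i : A) :
    0 ≤ partialDeriv (pgf χ j A) i x := by
  refine MonotoneOn.derivWithin_nonneg fun r hr r' hr' h => pgf_mono χ j ?_ ?_ ?_
  · exact le_update_iff.2 ⟨hr.1, fun l _ => hx.1 l⟩
  · exact update_le_update_iff.2 ⟨h, fun l _ => le_rfl⟩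
  · exact update_le_iff.2 ⟨hr'.2, fun l _ => hx.2 l⟩

/-- Convexity on the segment from `x` to `y`: the slope of the chord is at least the derivative at
the starting point, which the chain rule expresses by partial derivatives. -/
theorem pgf_add_sum_partialDeriv_le {x y : A → ℝ} (hx : 0 ≤ x) (hxy : x ≤ y) (hy : y ≤ 1)
    (hd : DifferentiableOn ℝ (pgf χ j A) (Set.Icc 0 1)) :
    pgf χ j A x + ∑ i, (y i - x i) * partialDeriv (pgf χ j A) i x ≤ pgf χ j A y := by
  have hx' : x ∈ Set.Icc (0 : A → ℝ) 1 := ⟨hx, hxy.trans hy⟩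
  have hxd : x + (y - x) = y := by abel
  have hconv := convexOn_pgf_line χ j hx (sub_nonneg.2 hxy) (hxd.trans_le hy)
  have hmaps : Set.MapsTo (fun r : ℝ => x + r • (y - x)) (Set.Icc 0 1) (Set.Icc 0 1) := by
    intro r hr
    exact ⟨add_nonneg hx (smul_nonneg hr.1 (sub_nonneg.2 hxy)), fun i => (add_le_add_right
      (mul_le_of_le_one_left (sub_nonneg.2 (hxy i)) hr.2) _).trans (by simpa using hy i)⟩
  have h1 : HasFDerivWithinAt (pgf χ j A) (fderivWithin ℝ (pgf χ j A) (Set.Icc 0 1) x)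
      (Set.Icc 0 1) (x + (0 : ℝ) • (y - x)) := by
    rw [zero_smul, add_zero]; exact (hd x hx').hasFDerivWithinAt
  have h2 : HasDerivAt (fun r : ℝ => x + r • (y - x)) (y - x) 0 := by
    simpa using ((hasDerivAt_id (0 : ℝ)).smul_const (y - x)).const_add x
  have h5 := h1.comp_hasDerivWithinAt 0 h2.hasDerivWithinAt hmaps
  have h3 := hconv.le_slope_of_hasDerivWithinAt (Set.left_mem_Icc.2 zero_le_one)
    (Set.right_mem_Icc.2 zero_le_one) zero_lt_one h5
  rw [slope_def_field] at h3
  simp only [one_smul, zero_smul, add_zero, hxd, sub_zero, div_one] at h3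
  have h4 : fderivWithin ℝ (pgf χ j A) (Set.Icc 0 1) x (y - x) =
      ∑ i, (y i - x i) * partialDeriv (pgf χ j A) i x := by
    conv_lhs => rw [← Finset.univ_sum_single (y - x), map_sum]
    refine Finset.sum_congr rfl fun i _ => ?_
    rw [partialDeriv_eq_fderivWithin χ j hx' (hd x hx'), ← smul_eq_mul, ← map_smul,
      ← Pi.single_smul, smul_eq_mul, mul_one]
    rfl
  linarith

theorem toReal_marginal (k : A → ℕ) :
    (marginal χ j A k).toReal = (χ j).toMeasure.real {n | ∀ c : A, n c = k c} := by
  rw [marginal_apply, Measure.real]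

/-- The zero exponent contributes `1 = r + (1 - r)` times its weight; every other monomial is a
positive power of `r`, hence at most `r`. -/
theorem pgf_const_le {r : ℝ} (hr : r ∈ Set.Icc (0 : ℝ) 1) :
    pgf χ j A (fun _ => r) ≤ r + (1 - r) * noChildProb χ j A := by
  classical
  have h0 : noChildProb χ j A = (marginal χ j A 0).toReal := by
    rw [toReal_marginal, noChildProb]
    simp
  have hs : Summable fun k : A → ℕ =>
      (1 - r) * ((if k = 0 then 1 else 0) * (marginal χ j A k).toReal) :=
    summable_of_ne_finset_zero (s := {0}) fun k hk => by
      rw [if_neg (by simpa using hk), zero_mul, mul_zero]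
  have hr' : (fun _ => r : A → ℝ) ∈ Set.Icc (0 : A → ℝ) 1 := ⟨fun _ => hr.1, fun _ => hr.2⟩
  calc pgf χ j A (fun _ => r)
      ≤ ∑' k : A → ℕ, (r * (marginal χ j A k).toReal +
          (1 - r) * ((if k = 0 then 1 else 0) * (marginal χ j A k).toReal)) := by
        refine (summable_pgf χ j hr').tsum_le_tsum (fun k => ?_)
          (((summable_marginal χ j).mul_left r).add hs)
        rw [← mul_assoc, ← add_mul]
        refine mul_le_mul_of_nonneg_right ?_ ENNReal.toReal_nonneg
        split_ifs with hk
        · simpa using (monomial_mem_Icc hr' k).2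
        · obtain ⟨i, hi⟩ := Function.ne_iff.1 hk
          rw [mul_zero, add_zero, Finset.prod_pow_eq_pow_sum]
          refine pow_le_of_le_one hr.1 hr.2 fun h => hi ?_
          exact Finset.sum_eq_zero_iff.1 h i (Finset.mem_univ i)
    _ = r + (1 - r) * noChildProb χ j A := by
        rw [((summable_marginal χ j).mul_left r).tsum_add hs, tsum_mul_left, tsum_marginal,
          tsum_mul_left, tsum_eq_single 0 (by simp +contextual), h0]
        simp

/-- Having a single child in `A`, of colour `i`, is the exponent `Pi.single i 1`, so
`monomial_add_le` can be summed term by term. -/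
theorem pgf_add_sum_onlyChildProb_le {u y : A → ℝ} {b : Fin m → ℝ} (hu : 0 ≤ u) (hb : 0 ≤ b)
    (huy : ∀ i : A, u i + b i ≤ y i) (hy : y ≤ 1) :
    pgf χ j A u + ∑ i ∈ A, b i * onlyChildProb χ j A i ≤ pgf χ j A y := by
  classical
  have huy' : u ≤ y := fun i => (le_add_of_nonneg_right (hb i)).trans (huy i)
  have h1 : ∀ i : A, onlyChildProb χ j A i = (marginal χ j A (Pi.single i 1)).toReal := by
    intro i
    rw [toReal_marginal, onlyChildProb]
    congr 1
    ext n
    simp only [Set.mem_ofPred_eq, Finset.mem_sdiff, Finset.mem_singleton]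
    constructor
    · rintro ⟨hi, h⟩ c
      by_cases hc : c = i
      · subst hc; simpa using hi
      · rw [Pi.single_eq_of_ne hc]
        exact h c ⟨c.2, fun h => hc (Subtype.ext h)⟩
    · intro h
      refine ⟨by simpa using h i, fun k hk => ?_⟩
      have := h ⟨k, hk.1⟩
      rwa [Pi.single_eq_of_ne fun h => hk.2 (congrArg Subtype.val h)] at this
  have hs : ∀ i : A, HasSum (fun k : A → ℕ =>
      b i * ((if k = Pi.single i 1 then 1 else 0) * (marginal χ j A k).toReal))
      (b i * onlyChildProb χ j A i) := by
    intro i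
    rw [h1]
    refine HasSum.mul_left _ ?_
    have := hasSum_single (f := fun k : A → ℕ =>
      (if k = Pi.single i 1 then 1 else 0) * (marginal χ j A k).toReal) (Pi.single i 1)
      (fun k hk => by simp [hk])
    rwa [if_pos rfl, one_mul] at this
  have hsum := hasSum_sum fun (i : A) (_ : i ∈ Finset.univ) => hs i
  rw [← Finset.sum_coe_sort A fun i => b i * onlyChildProb χ j A i]
  have hsu := (summable_pgf χ j ⟨hu, huy'.trans hy⟩).hasSum
  refine hasSum_le (fun k => ?_) (hsu.add hsum)
    (summable_pgf χ j ⟨hu.trans huy', hy⟩).hasSum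
  have := mul_le_mul_of_nonneg_right (monomial_add_le hu (b := fun i : A => b i)
    (fun i => hb i) huy k) (ENNReal.toReal_nonneg (a := marginal χ j A k))
  rw [add_mul, Finset.sum_mul] at this
  simpa only [mul_assoc] using this

theorem ofReal_pgf {x : A → ℝ} (hx : x ∈ Set.Icc 0 1) :
    ENNReal.ofReal (pgf χ j A x) =
      ∑' k : A → ℕ, ENNReal.ofReal (∏ i, x i ^ k i) * marginal χ j A k := by
  rw [pgf, ENNReal.ofReal_tsum_of_nonneg
    (fun k => mul_nonneg (monomial_mem_Icc hx k).1 ENNReal.toReal_nonneg) (summable_pgf χ j hx)]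
  refine tsum_congr fun k => ?_
  rw [ENNReal.ofReal_mul (monomial_mem_Icc hx k).1, ENNReal.ofReal_toReal (PMF.apply_ne_top _ _)]

theorem meanChildren_eq_tsum (i : A) :
    meanChildren χ j i = ∑' k : A → ℕ, (k i : ℝ≥0∞) * marginal χ j A k := by
  have hm : Measurable fun (n : Fin m → ℕ) (c : A) => n c := by fun_prop
  have h : ∑' k : A → ℕ, (k i : ℝ≥0∞) * marginal χ j A k =
      ∫⁻ k, (k i : ℝ≥0∞) ∂(marginal χ j A).toMeasure := by
    rw [lintegral_countable']
    exact tsum_congr fun k => by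
      rw [PMF.toMeasure_apply_singleton _ k (measurableSet_singleton k)]
  rw [h, marginal, ← PMF.toMeasure_map _ (χ j) hm, lintegral_map (by fun_prop) hm, meanChildren]

/-- The sum of `monomial_le_add` over all exponents. It is carried out in `ℝ≥0∞` because the means
may be infinite. -/
theorem pgf_le_add_of_meanChildren {a b : A → ℝ} {β : Fin m → ℝ} {α : ℝ}
    (ha : a ∈ Set.Icc 0 1) (hb : b ∈ Set.Icc 0 1) (hβ : 0 ≤ β) (hα : 0 ≤ α)
    (hab : ∀ i : A, a i ≤ b i + β i)
    (h : ∑ i ∈ A, ENNReal.ofReal (β i) * meanChildren χ j i ≤ ENNReal.ofReal α) :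
    pgf χ j A a ≤ pgf χ j A b + α := by
  have hbnn : 0 ≤ pgf χ j A b :=
    tsum_nonneg fun k => mul_nonneg (monomial_mem_Icc hb k).1 ENNReal.toReal_nonneg
  rw [← ENNReal.ofReal_le_ofReal_iff (add_nonneg hbnn hα), ENNReal.ofReal_add hbnn hα]
  refine le_trans ?_ (add_le_add_right h _)
  rw [← Finset.sum_coe_sort A fun i => ENNReal.ofReal (β i) * meanChildren χ j i]
  simp only [meanChildren_eq_tsum, ← ENNReal.tsum_mul_left]
  rw [ofReal_pgf χ j ha, ofReal_pgf χ j hb, ← tsum_fintype (L := .unconditional A),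
    ENNReal.tsum_comm, ← ENNReal.tsum_add]
  refine ENNReal.tsum_le_tsum fun k => ?_
  simp only [← mul_assoc]
  rw [tsum_fintype, ← Finset.sum_mul, ← add_mul]
  refine mul_le_mul_left ?_ _
  have hk := monomial_le_add ha hb (β := fun i : A => β i) (fun i => hβ i) hab k
  refine (ENNReal.ofReal_le_ofReal hk).trans_eq ?_
  have hnn : ∀ i : A, 0 ≤ β i * (k i : ℝ) := fun i => mul_nonneg (hβ i) (Nat.cast_nonneg _)
  rw [ENNReal.ofReal_add (monomial_mem_Icc hb k).1 (Finset.sum_nonneg fun i _ => hnn i),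
    ENNReal.ofReal_sum_of_nonneg fun i _ => hnn i]
  congr 1
  refine Finset.sum_congr rfl fun i _ => ?_
  rw [ENNReal.ofReal_mul (hβ i), ENNReal.ofReal_natCast]

end Pgf

/-! ### Recursions for the winning probabilities -/

section Recursion

variable {m : ℕ} (χ : Fin m → PMF (Fin m → ℕ)) (S : Fin m → Finset (Fin m)) (q : Player)
  (t : Player → Prop)

/-- The probability that `q` wins within a bounded number of moves, in terms of the number of
moves, the player to move and the colour of the root. -/
noncomputable def winSetProb (n : ℕ) (p : Player) (j : Fin m) : ℝ :=
  (offspringLaw χ j).real (winSet S q t n p j)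

/-- The probability that `q` wins, in terms of the first player and the colour of the root. -/
noncomputable def eventualWinProb (p : Player) (j : Fin m) : ℝ :=
  (offspringLaw χ j).real (⋃ n, winSet S q t n p j)

theorem winSetProb_zero (p : Player) (j : Fin m) : winSetProb χ S q t 0 p j = 0 := by
  simp [winSetProb, winSet]

theorem winSetProb_mem_Icc (n : ℕ) (p : Player) (j : Fin m) :
    winSetProb χ S q t n p j ∈ Set.Icc (0 : ℝ) 1 := ⟨measureReal_nonneg, measureReal_le_one⟩

theorem eventualWinProb_mem_Icc (p : Player) (j : Fin m) :
    eventualWinProb χ S q t p j ∈ Set.Icc (0 : ℝ) 1 := ⟨measureReal_nonneg, measureReal_le_one⟩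

theorem tendsto_winSetProb (p : Player) (j : Fin m) :
    Tendsto (fun n => winSetProb χ S q t n p j) atTop (𝓝 (eventualWinProb χ S q t p j)) :=
  (ENNReal.tendsto_toReal (measure_ne_top _ _)).comp
    (tendsto_measure_iUnion_atTop (winSet_mono S q t p j))

theorem childrenIn_mono {A : Finset (Fin m)} {E F : Fin m → Set (Node m → Fin m → ℕ)}
    (h : ∀ c, E c ⊆ F c) : childrenIn A E ⊆ childrenIn A F :=
  fun _ hX c hc a ha => h c (hX c hc a ha)

open Classical in
-- The generating function is the probability that no move reaches a won subtree. It includes the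
-- case of a stuck root, which is added back when being stuck is a win.
theorem winSetProb_succ_self (n : ℕ) (j : Fin m) :
    winSetProb χ S q t (n + 1) q j =
      1 - pgf χ j (moveSet S q j) (fun c => 1 - winSetProb χ S q t n q.other c) +
        if t q then noChildProb χ j (moveSet S q j) else 0 := by
  have hE : ∀ c, MeasurableSet (winSet S q t n q.other c)ᶜ := fun c =>
    (measurableSet_winSet S q t n q.other c).compl
  have h1 := real_childrenIn χ j (moveSet S q j) hE
  simp only [probReal_compl_eq_one_sub (measurableSet_winSet S q t n q.other _)] at h1
  have hmeas := measurableSet_childrenIn (moveSet S q j) hE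
  have h0 := measurableSet_childrenIn (m := m) (moveSet S q j) (E := fun _ => ∅)
    fun _ => MeasurableSet.empty
  rw [winSetProb, winSet, if_pos rfl]
  split_ifs with ht
  · simp only [ht, and_true, Set.ofPred_mem_eq]
    rw [measureReal_union _ h0, probReal_compl_eq_one_sub hmeas, h1, real_childrenIn_empty]
    · rfl
    · exact Set.disjoint_left.2 fun X hX hX' => hX (childrenIn_mono (fun _ => Set.empty_subset _) hX')
  · simp only [ht, and_false, Set.ofPred_false, Set.union_empty, add_zero]
    rw [probReal_compl_eq_one_sub hmeas, h1]
    rfl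

open Classical in
-- The condition on all moves holds vacuously at a stuck root, which is removed unless it is a win
-- for `q`.
theorem winSetProb_succ_other (n : ℕ) (j : Fin m) :
    winSetProb χ S q t (n + 1) q.other j =
      pgf χ j (moveSet S q.other j) (fun c => winSetProb χ S q t n q c) -
        if t q.other then 0 else noChildProb χ j (moveSet S q.other j) := by
  have h1 := real_childrenIn χ j (moveSet S q.other j) fun c => measurableSet_winSet S q t n q c
  have h0 := measurableSet_childrenIn (m := m) (moveSet S q.other j) (E := fun _ => ∅)
    fun _ => MeasurableSet.empty
  rw [winSetProb, winSet, if_neg q.other_ne, Player.other_other]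
  split_ifs with ht
  · simp only [ht, not_true, and_false, Set.ofPred_false, Set.sdiff_empty, sub_zero]
    exact h1
  · simp only [ht, not_false_iff, and_true, Set.ofPred_mem_eq]
    rw [measureReal_sdiff (childrenIn_mono fun _ => Set.empty_subset _) h0, h1,
      real_childrenIn_empty]
    rfl

theorem tendsto_pgf {j : Fin m} {A : Finset (Fin m)} {x : ℕ → A → ℝ} {y : A → ℝ}
    (hx : ∀ n, x n ∈ Set.Icc 0 1) (hy : y ∈ Set.Icc 0 1)
    (h : ∀ i, Tendsto (fun n => x n i) atTop (𝓝 (y i))) :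
    Tendsto (fun n => pgf χ j A (x n)) atTop (𝓝 (pgf χ j A y)) :=
  (continuousOn_pgf χ j y hy).tendsto.comp (tendsto_nhdsWithin_iff.2
    ⟨tendsto_pi_nhds.2 h, Eventually.of_forall hx⟩)

open Classical in
theorem eventualWinProb_self (j : Fin m) :
    eventualWinProb χ S q t q j =
      1 - pgf χ j (moveSet S q j) (fun c => 1 - eventualWinProb χ S q t q.other c) +
        if t q then noChildProb χ j (moveSet S q j) else 0 := by
  refine tendsto_nhds_unique ((tendsto_winSetProb χ S q t q j).comp (tendsto_add_atTop_nat 1)) ?_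
  simp only [Function.comp_def, winSetProb_succ_self]
  refine (tendsto_const_nhds.sub (tendsto_pgf χ (fun n => ?_) ?_ fun i =>
    tendsto_const_nhds.sub (tendsto_winSetProb χ S q t q.other i))).add_const _
  · exact ⟨fun i => sub_nonneg.2 (winSetProb_mem_Icc χ S q t n _ _).2,
      fun i => sub_le_self _ (winSetProb_mem_Icc χ S q t n _ _).1⟩
  · exact ⟨fun i => sub_nonneg.2 (eventualWinProb_mem_Icc χ S q t _ _).2,
      fun i => sub_le_self _ (eventualWinProb_mem_Icc χ S q t _ _).1⟩

open Classical in
theorem eventualWinProb_other (j : Fin m) :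
    eventualWinProb χ S q t q.other j =
      pgf χ j (moveSet S q.other j) (fun c => eventualWinProb χ S q t q c) -
        if t q.other then 0 else noChildProb χ j (moveSet S q.other j) := by
  refine tendsto_nhds_unique
    ((tendsto_winSetProb χ S q t q.other j).comp (tendsto_add_atTop_nat 1)) ?_
  simp only [Function.comp_def, winSetProb_succ_other]
  exact (tendsto_pgf χ (fun n => ⟨fun i => (winSetProb_mem_Icc χ S q t n _ _).1,
    fun i => (winSetProb_mem_Icc χ S q t n _ _).2⟩)
    ⟨fun i => (eventualWinProb_mem_Icc χ S q t _ _).1,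
      fun i => (eventualWinProb_mem_Icc χ S q t _ _).2⟩
    fun i => tendsto_winSetProb χ S q t q i).sub_const _

variable {q t} in
theorem gwLawFrom_real_hasWinningStrategy {g : Game} {first : Player}
    (hg : ∀ len : ℕ∞, WinsPlay g first q len ↔ ∃ n : ℕ, len = n ∧ t (mover first n))
    (j : Fin m) :
    (gwLawFrom χ j).real {T | HasWinningStrategy T.tree S g first q []} =
      eventualWinProb χ S q t first j := by
  -- `Prod.mk j` is a measurable embedding, so the pushforward can be evaluated without first
  -- knowing that the event is measurable.
  rw [eventualWinProb, Measure.real, Measure.real, gwLawFrom,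
    (measurableEmbedding_prodMk_left j).map_apply]
  congr 2
  ext X
  simp only [Set.mem_preimage, Set.mem_ofPred_eq, Set.mem_iUnion]
  rw [hasWinningStrategy_iff hg fun p u => finite_permissible_tree S p _ u]
  exact exists_congr fun n => winsWithin_tree_iff

/-- If the opponent of `q` starts and a condition on the probabilities of a single child holds,
`q` is at least as likely to win the misère game as the normal game. -/
theorem eventualWinProb_other_normal_le_misere
    (h : ∀ j, noChildProb χ j (moveSet S q.other j) ≤ ∑ i ∈ moveSet S q.other j,
      noChildProb χ i (moveSet S q i) * onlyChildProb χ j (moveSet S q.other j) i) (j : Fin m) :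
    eventualWinProb χ S q (· ≠ q) q.other j ≤ eventualWinProb χ S q (· = q) q.other j := by
  have hM := eventualWinProb_mem_Icc χ S q (· = q)
  have hself := eventualWinProb_self χ S q (· = q)
  have hother := eventualWinProb_other χ S q (· = q)
  have hN := winSetProb_mem_Icc χ S q (· ≠ q)
  simp only [if_true, q.other_ne, if_false] at hself hother
  have hβ : 0 ≤ fun i => noChildProb χ i (moveSet S q i) := fun i => measureReal_nonneg
  -- The gap at the turns of `q` is the chance that `q` is stuck at once, a win only in the misère
  -- game. Passing through a single child, it pays for the term subtracted in `hother`.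
  have key : ∀ n, (∀ j, winSetProb χ S q (· ≠ q) n q.other j ≤
      eventualWinProb χ S q (· = q) q.other j) ∧
      ∀ j, winSetProb χ S q (· ≠ q) n q j + noChildProb χ j (moveSet S q j) ≤
        eventualWinProb χ S q (· = q) q j := by
    intro n
    induction n with
    | zero =>
      refine ⟨fun j => by rw [winSetProb_zero]; exact (hM _ _).1, fun j => ?_⟩
      rw [winSetProb_zero, hself, zero_add]
      refine le_add_of_nonneg_left (sub_nonneg.2 (pgf_le_one χ j ?_))
      exact ⟨fun i => sub_nonneg.2 (hM _ _).2, fun i => sub_le_self _ (hM _ _).1⟩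
    | succ n ih =>
      refine ⟨fun j => ?_, fun j => ?_⟩
      · rw [winSetProb_succ_other, if_pos q.other_ne, sub_zero, hother]
        have := pgf_add_sum_onlyChildProb_le χ j (A := moveSet S q.other j)
          (u := fun c => winSetProb χ S q (· ≠ q) n q c)
          (y := fun c => eventualWinProb χ S q (· = q) q c) (fun i => (hN _ _ _).1) hβ
          (fun i => ih.2 i) fun i => (hM _ _).2
        linarith [h j]
      · rw [winSetProb_succ_self, if_neg (not_not.2 rfl), add_zero, hself]
        refine add_le_add_left (sub_le_sub_left (pgf_mono χ j ?_ ?_ ?_) _) _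
        · exact fun i => sub_nonneg.2 (hM _ _).2
        · exact fun i => sub_le_sub_left (ih.1 i) _
        · exact fun i => sub_le_self _ (hN _ _ _).1
  exact le_of_tendsto' (tendsto_winSetProb χ S q _ q.other j) fun n => (key n).1 j

/-- If `q` starts and a condition on the mean numbers of children holds, `q` is at least as likely
to win the misère game as the normal game. -/
theorem eventualWinProb_self_normal_le_misere
    (h : ∀ j, ENNReal.ofReal (noChildProb χ j (moveSet S q j)) ≥ ∑ i ∈ moveSet S q j,
      ENNReal.ofReal (noChildProb χ i (moveSet S q.other i)) * meanChildren χ j i) (j : Fin m) :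
    eventualWinProb χ S q (· ≠ q) q j ≤ eventualWinProb χ S q (· = q) q j := by
  have hM := eventualWinProb_mem_Icc χ S q (· = q)
  have hself := eventualWinProb_self χ S q (· = q)
  have hother := eventualWinProb_other χ S q (· = q)
  have hN := winSetProb_mem_Icc χ S q (· ≠ q)
  simp only [if_true, q.other_ne, if_false] at hself hother
  have hβ : 0 ≤ fun i => noChildProb χ i (moveSet S q.other i) := fun i => measureReal_nonneg
  -- Here the normal value may exceed the misère value at the opponent's turns, by at most the
  -- chance that the opponent is stuck. By the mean condition, the resulting loss at the turn of `q`
  -- is covered by the term added in `hself`.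
  have key : ∀ n, (∀ j, winSetProb χ S q (· ≠ q) n q j ≤ eventualWinProb χ S q (· = q) q j) ∧
      ∀ j, winSetProb χ S q (· ≠ q) n q.other j ≤
        eventualWinProb χ S q (· = q) q.other j + noChildProb χ j (moveSet S q.other j) := by
    intro n
    induction n with
    | zero =>
      simp only [winSetProb_zero]
      exact ⟨fun j => (hM _ _).1, fun j => add_nonneg (hM _ _).1 (hβ j)⟩
    | succ n ih =>
      refine ⟨fun j => ?_, fun j => ?_⟩
      · rw [winSetProb_succ_self, if_neg (not_not.2 rfl), add_zero, hself]
        have := pgf_le_add_of_meanChildren χ j (A := moveSet S q j)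
          (a := fun c => 1 - eventualWinProb χ S q (· = q) q.other c)
          (α := noChildProb χ j (moveSet S q j))
          (b := fun c => 1 - winSetProb χ S q (· ≠ q) n q.other c)
          ⟨fun i => sub_nonneg.2 (hM _ _).2, fun i => sub_le_self _ (hM _ _).1⟩
          ⟨fun i => sub_nonneg.2 (hN _ _ _).2, fun i => sub_le_self _ (hN _ _ _).1⟩ hβ
          measureReal_nonneg (fun i => by linarith [ih.2 i]) (h j)
        linarith
      · rw [winSetProb_succ_other, if_pos q.other_ne, sub_zero, hother, sub_add_cancel]
        exact pgf_mono χ j (fun i => (hN _ _ _).1) (fun i => ih.1 i) fun i => (hM _ _).2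
  exact le_of_tendsto' (tendsto_winSetProb χ S q _ q j) fun n => (key n).1 j

/-- Lower bounds for `1 - G (1 - l) + G 0`, where `G` is a generating function. -/
theorem one_sub_pgf_bounds (j : Fin m) {A : Finset (Fin m)} (hA : A.Nonempty)
    (hd : DifferentiableOn ℝ (pgf χ j A) (Set.Icc 0 1)) {l : Fin m → ℝ} {w : ℝ}
    (hl : ∀ i, l i ∈ Set.Icc (0 : ℝ) 1)
    (hw : w = 1 - pgf χ j A (fun i => 1 - l i) + noChildProb χ j A) :
    w ≥ noChildProb χ j A + A.inf' hA (fun i => l i) * (1 - noChildProb χ j A)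
        + ∑ k : A, (l k - A.inf' hA (fun i => l i)) *
          partialDeriv (pgf χ j A) k (fun i => 1 - l i) ∧
      noChildProb χ j A + A.inf' hA (fun i => l i) * (1 - noChildProb χ j A)
        + ∑ k : A, (l k - A.inf' hA (fun i => l i)) *
          partialDeriv (pgf χ j A) k (fun i => 1 - l i) ≥ A.inf' hA (fun i => l i) := by
  set e := A.inf' hA (fun i => l i) with he
  have hle : ∀ i : A, e ≤ l i := fun i => Finset.inf'_le _ i.2
  have he0 : 0 ≤ e := Finset.le_inf' _ _ fun i _ => (hl i).1
  have he1 : e ≤ 1 := (hle ⟨_, hA.choose_spec⟩).trans (hl _).2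
  have hx : (fun i : A => 1 - l i) ∈ Set.Icc (0 : A → ℝ) 1 :=
    ⟨fun i => sub_nonneg.2 (hl i).2, fun i => sub_le_self _ (hl i).1⟩
  constructor
  -- As `e` is the minimum, the constant vector `1 - e` dominates `1 - l`, and the increments become
  -- `l i - e`.
  · have h1 := pgf_add_sum_partialDeriv_le χ j hx.1 (y := fun _ => 1 - e)
      (fun i => sub_le_sub_left (hle i) _) (fun i => sub_le_self _ he0) hd
    have h2 := pgf_const_le χ j (A := A) (r := 1 - e) ⟨sub_nonneg.2 he1, sub_le_self _ he0⟩
    simp only [sub_sub_sub_cancel_left] at h1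
    rw [hw]
    linarith
  · have h1 : 0 ≤ ∑ k : A, (l k - e) * partialDeriv (pgf χ j A) k (fun i => 1 - l i) :=
      Finset.sum_nonneg fun k _ =>
        mul_nonneg (sub_nonneg.2 (hle k)) (partialDeriv_pgf_nonneg χ j hx k)
    have h2 : 0 ≤ noChildProb χ j A * (1 - e) :=
      mul_nonneg measureReal_nonneg (sub_nonneg.2 he1)
    linarith

theorem mw_eq (i : Player) (j : Fin m) : mw χ S i j = eventualWinProb χ S i (· = i) i j :=
  gwLawFrom_real_hasWinningStrategy χ S (winsPlay_misere_iff i i) j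

theorem nw_eq (i : Player) (j : Fin m) : nw χ S i j = eventualWinProb χ S i (· ≠ i) i j :=
  gwLawFrom_real_hasWinningStrategy χ S (winsPlay_normal_iff i i) j

theorem ml_eq (i : Player) (j : Fin m) :
    ml χ S i j = eventualWinProb χ S i.other (· = i.other) i j :=
  gwLawFrom_real_hasWinningStrategy χ S (winsPlay_misere_iff i i.other) j

theorem nl_eq (i : Player) (j : Fin m) :
    nl χ S i j = eventualWinProb χ S i.other (· ≠ i.other) i j :=
  gwLawFrom_real_hasWinningStrategy χ S (winsPlay_normal_iff i i.other) j

theorem esw_eq (j : Fin m) : esw χ S j = eventualWinProb χ S .P1 (fun _ => True) .P1 j :=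
  gwLawFrom_real_hasWinningStrategy χ S (winsPlay_escape_iff .P1) j

theorem eel_eq (j : Fin m) : eel χ S j = eventualWinProb χ S .P1 (fun _ => True) .P2 j :=
  gwLawFrom_real_hasWinningStrategy χ S (winsPlay_escape_iff .P2) j

end Recursion

/-- The same strategy works: Stopper only needs the play to be finite. -/
theorem hasWinningStrategy_escape {m : ℕ} {V : Type*} {D : ColouredDigraph m V}
    {S : Fin m → Finset (Fin m)} {g : Game} {first : Player} {v₀ : V}
    (hg : ∀ len, WinsPlay g first .P1 len → len ≠ ⊤)
    (h : HasWinningStrategy D S g first .P1 v₀) :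
    HasWinningStrategy D S .escape first .P1 v₀ :=
  h.imp fun _ hs => hs.imp_right fun hw len pos hplay hfollow => hg len (hw len pos hplay hfollow)

theorem real_hasWinningStrategy_le_escape {m : ℕ} (μ : Measure (Realization m))
    [IsFiniteMeasure μ] (S : Fin m → Finset (Fin m)) {g : Game} {first : Player}
    (hg : ∀ len, WinsPlay g first .P1 len → len ≠ ⊤) :
    μ.real {T | HasWinningStrategy T.tree S g first .P1 []} ≤
      μ.real {T | HasWinningStrategy T.tree S .escape first .P1 []} :=
  measureReal_mono fun _ hT => hasWinningStrategy_escape hg hT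

theorem winsPlay_normal_ne_top {first q : Player} (len : ℕ∞) (h : WinsPlay .normal first q len) :
    len ≠ ⊤ := by
  obtain ⟨n, rfl, -⟩ := h
  exact ENat.natCast_ne_top n

theorem winsPlay_misere_ne_top {first q : Player} (len : ℕ∞) (h : WinsPlay .misere first q len) :
    len ≠ ⊤ := by
  obtain ⟨n, rfl, -⟩ := h
  exact ENat.natCast_ne_top n

end MultiTypeGW

theorem theorem4 {m : ℕ} (χ : Fin m → PMF (Fin m → ℕ)) (S : Fin m → Finset (Fin m))
    (hS : ∀ j, (S j).Nonempty) (hS' : ∀ j, (S j)ᶜ.Nonempty) :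
    -- comparison with the escape game
    (∀ j, nw χ S .P1 j ≤ esw χ S j ∧ nl χ S .P2 j ≤ eel χ S j ∧
      mw χ S .P1 j ≤ esw χ S j ∧ ml χ S .P2 j ≤ eel χ S j) ∧
    -- lower bounds through partial derivatives
    (∀ j,
      DifferentiableOn ℝ (pgf χ j (S j)) (Set.Icc 0 1) →
      DifferentiableOn ℝ (pgf χ j (S j)ᶜ) (Set.Icc 0 1) →
      (esw χ S j ≥
          alphaS χ S j + (S j).inf' (hS j) (fun t => eel χ S t) * (1 - alphaS χ S j)
            + ∑ k : S j, (eel χ S k - (S j).inf' (hS j) (fun t => eel χ S t)) *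
                partialDeriv (pgf χ j (S j)) k (fun t => 1 - eel χ S t) ∧
        alphaS χ S j + (S j).inf' (hS j) (fun t => eel χ S t) * (1 - alphaS χ S j)
            + ∑ k : S j, (eel χ S k - (S j).inf' (hS j) (fun t => eel χ S t)) *
                partialDeriv (pgf χ j (S j)) k (fun t => 1 - eel χ S t) ≥
          (S j).inf' (hS j) (fun t => eel χ S t)) ∧
      (mw χ S .P1 j ≥
          alphaS χ S j + (S j).inf' (hS j) (fun t => ml χ S .P2 t) * (1 - alphaS χ S j)
            + ∑ k : S j, (ml χ S .P2 k - (S j).inf' (hS j) (fun t => ml χ S .P2 t)) *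
                partialDeriv (pgf χ j (S j)) k (fun t => 1 - ml χ S .P2 t) ∧
        alphaS χ S j + (S j).inf' (hS j) (fun t => ml χ S .P2 t) * (1 - alphaS χ S j)
            + ∑ k : S j, (ml χ S .P2 k - (S j).inf' (hS j) (fun t => ml χ S .P2 t)) *
                partialDeriv (pgf χ j (S j)) k (fun t => 1 - ml χ S .P2 t) ≥
          (S j).inf' (hS j) (fun t => ml χ S .P2 t)) ∧
      (mw χ S .P2 j ≥
          betaS χ S j + (S j)ᶜ.inf' (hS' j) (fun t => ml χ S .P1 t) * (1 - betaS χ S j)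
            + ∑ k : ↥(S j)ᶜ, (ml χ S .P1 k - (S j)ᶜ.inf' (hS' j) (fun t => ml χ S .P1 t)) *
                partialDeriv (pgf χ j (S j)ᶜ) k (fun t => 1 - ml χ S .P1 t) ∧
        betaS χ S j + (S j)ᶜ.inf' (hS' j) (fun t => ml χ S .P1 t) * (1 - betaS χ S j)
            + ∑ k : ↥(S j)ᶜ, (ml χ S .P1 k - (S j)ᶜ.inf' (hS' j) (fun t => ml χ S .P1 t)) *
                partialDeriv (pgf χ j (S j)ᶜ) k (fun t => 1 - ml χ S .P1 t) ≥
          (S j)ᶜ.inf' (hS' j) (fun t => ml χ S .P1 t))) ∧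
    -- comparison of the normal and the misère game, P1 playing the first round
    ((∀ j, ConvexOn ℝ (Set.Icc 0 1) (pgf χ j (S j)) ∧
        ContDiffOn ℝ 1 (pgf χ j (S j)) (Set.Icc 0 1) ∧
        ContinuousOn (pgf χ j (S j)ᶜ) (Set.Icc 0 1)) →
      ((∀ j, alphaS χ S j ≤ ∑ i ∈ S j, betaS χ S i * onlyChildProb χ j (S j) i) →
        ∀ j, nl χ S .P1 j ≤ ml χ S .P1 j) ∧
      ((∀ j, ENNReal.ofReal (alphaS χ S j) ≥
          ∑ i ∈ S j, ENNReal.ofReal (betaS χ S i) * meanChildren χ j i) →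
        ∀ j, nw χ S .P1 j ≤ mw χ S .P1 j)) ∧
    -- comparison of the normal and the misère game, P2 playing the first round
    ((∀ j, ConvexOn ℝ (Set.Icc 0 1) (pgf χ j (S j)ᶜ) ∧
        ContDiffOn ℝ 1 (pgf χ j (S j)ᶜ) (Set.Icc 0 1) ∧
        ContinuousOn (pgf χ j (S j)) (Set.Icc 0 1)) →
      ((∀ j, betaS χ S j ≤ ∑ i ∈ (S j)ᶜ, alphaS χ S i * onlyChildProb χ j (S j)ᶜ i) →
        ∀ j, nl χ S .P2 j ≤ ml χ S .P2 j) ∧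
      ((∀ j, ENNReal.ofReal (betaS χ S j) ≥
          ∑ i ∈ (S j)ᶜ, ENNReal.ofReal (alphaS χ S i) * meanChildren χ j i) →
        ∀ j, nw χ S .P2 j ≤ mw χ S .P2 j)) := by
  have hl := fun i t => (ml_eq χ S i t).symm ▸ eventualWinProb_mem_Icc χ S i.other _ i t
  have hE := fun t => (eel_eq χ S t).symm ▸ eventualWinProb_mem_Icc χ S .P1 _ .P2 t
  refine ⟨fun j => ⟨real_hasWinningStrategy_le_escape _ S winsPlay_normal_ne_top,
    real_hasWinningStrategy_le_escape _ S winsPlay_normal_ne_top,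
    real_hasWinningStrategy_le_escape _ S winsPlay_misere_ne_top,
    real_hasWinningStrategy_le_escape _ S winsPlay_misere_ne_top⟩, fun j h1 h2 => ⟨?_, ?_, ?_⟩,
    fun _ => ⟨fun h j => ?_, fun h j => ?_⟩, fun _ => ⟨fun h j => ?_, fun h j => ?_⟩⟩
  · refine one_sub_pgf_bounds χ j (hS j) h1 hE ?_
    simp only [esw_eq, eel_eq]
    rw [eventualWinProb_self, if_pos trivial]
    rfl
  · refine one_sub_pgf_bounds χ j (hS j) h1 (hl .P2) ?_
    simp only [mw_eq, ml_eq]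
    rw [eventualWinProb_self, if_pos rfl]
    rfl
  · refine one_sub_pgf_bounds χ j (hS' j) h2 (hl .P1) ?_
    simp only [mw_eq, ml_eq]
    rw [eventualWinProb_self, if_pos rfl]
    rfl
  · rw [nl_eq, ml_eq]
    -- A loss of `P1` is a win of `P2` with the opponent starting, hence `q = .P2`.
    exact eventualWinProb_other_normal_le_misere χ S .P2 h j
  · rw [nw_eq, mw_eq]
    exact eventualWinProb_self_normal_le_misere χ S .P1 h j
  · rw [nl_eq, ml_eq]
    exact eventualWinProb_other_normal_le_misere χ S .P1 h j
  · rw [nw_eq, mw_eq]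
    exact eventualWinProb_self_normal_le_misere χ S .P2 h j
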